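/- Let $(\mathcal C,\wedge,\mathbb I_{\mathcal C})$ be a cofibrantly generated symmetric monoidal model category. Here this means: $\mathcal C$ is a model category with all small colimits; there are sets $I$, $J$ of morphisms permitting the small object argument such that the trivial fibrations (resp. the fibrations) are exactly the maps with the right lifting property with respect to $I$ (resp. $J$); $\wedge$ is a symmetric monoidal structure on $\mathcal C$ which preserves small colimits in each variable (for instance a closed one); and the pushout-product axiom holds: for cofibrations $f\colon K\to K'$ and $g\colon L\to L'$ the map $K'\wedge L\amalg_{K\wedge L}K\wedge L'\to K'\wedge L'$ is a cofibration, which is acyclic if $f$ or $g$ is. (No condition on the unit is required.) A symmetric sequence in $\mathcal C$ is a functor from the category $FinSet$ of finite sets and bijections to $\mathcal C$. The category $[FinSet,\mathcal C]$ carries the projective model structure: weak equivalences and fibrations are objectwise, and cofibrations are the maps with the left lifting property with respect to objectwise trivial fibrations. The composition product of two symmetric sequences is $$(M\circ N)(J)=\operatorname*{colim}_{f\colon J\to I}\ M(I)\wedge\bigwedge_{i\in I}N(f^{-1}(i)),$$ where the colimit runs over the category whose objects are all maps $f\colon J\to I$ with $I=\{1,\dots,r\}$, $r\ge 0$, and whose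 morphisms from $f\colon J\to I$ to $f'\colon J\to I'$ are the bijections $\sigma\colon I\to I'$ with $f'=\sigma\circ f$; $\sigma$ acts by $M(\sigma)$ and by permuting the smash factors. Bijections $\theta\colon J\to J'$ act through $f\mapsto f\circ\theta^{-1}$ and the maps $N(f^{-1}(i))\to N(\theta(f^{-1}(i)))$. Let $i\colon A\to A'$ and $j\colon B\to B'$ be cofibrations in $[FinSet,\mathcal C]$ such that $B$ and $B'$ are cofibrant. Then the natural map $$(i_*,j_*)\colon A'\circ B\ \amalg_{A\circ B}\ A\circ B'\longrightarrow A'\circ B'$$ is a cofibration in $[FinSet,\mathcal C]$. If moreover $i$ or $j$ is a weak equivalence, then so is $(i_*,j_*)$. -/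

import Mathlib

open CategoryTheory MonoidalCategory Limits HomotopicalAlgebra

universe v u

/-! ### Tensor products of finite families, and their reordering isomorphisms -/

namespace FamilyTensor

section

variable {I I' I'' : Type}

/-- `Ins a t l` records a way of obtaining the list `l` by inserting the entry `a` somewhere in
the list `t`. -/
inductive Ins (a : I) : List I → List I → Type
  | here (t : List I) : Ins a t (a :: t)
  | there (b : I) {t l : List I} (p : Ins a t l) : Ins a (b :: t) (b :: l)

/-- `Match s l l'` records a way of identifying `l'` with a reordering of the list obtained
from `l` by applying `s` to all the entries. -/
inductive Match (s : I → I') : List I → List I' → Type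
  | nil : Match s [] []
  | cons {a : I} {t : List I} {t' l' : List I'} (p : Match s t t') (q : Ins (s a) t' l') :
      Match s (a :: t) l'

theorem Ins.mem {a b : I} {t l : List I} (p : Ins a t l) (h : b ∈ t) : b ∈ l := by
  induction p with
  | here t => exact List.mem_cons_of_mem _ h
  | there c p ih =>
    rcases List.mem_cons.1 h with h | h
    · simp [h]
    · exact List.mem_cons_of_mem _ (ih h)

theorem Ins.self_mem {a : I} {t l : List I} (p : Ins a t l) : a ∈ l := by
  induction p with
  | here t => simp
  | there c p ih => exact List.mem_cons_of_mem _ ih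

theorem Ins.nodup {a : I} {t l : List I} (p : Ins a t l) (h : l.Nodup) : t.Nodup := by
  induction p with
  | here t => exact (List.nodup_cons.1 h).2
  | there c p ih =>
    rw [List.nodup_cons] at h ⊢
    exact ⟨fun hc => h.1 (p.mem hc), ih h.2⟩

theorem Ins.unique {a : I} {l : List I} (h : l.Nodup) :
    ∀ x y : (Σ t : List I, Ins a t l), x = y := by
  induction l with
  | nil => rintro ⟨t, p⟩; cases p
  | cons b l ih =>
    rw [List.nodup_cons] at h
    rintro ⟨t, p⟩ ⟨t', p'⟩
    cases p with
    | here =>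
      cases p' with
      | here => rfl
      | there _ p' => exact absurd p'.self_mem h.1
    | there _ p =>
      cases p' with
      | here => exact absurd p.self_mem h.1
      | there _ p' =>
        have := ih h.2 ⟨_, p⟩ ⟨_, p'⟩
        cases this
        rfl

theorem Match.unique {s : I → I'} {l : List I} {l' : List I'} (h : l'.Nodup)
    (x y : Match s l l') : x = y := by
  induction x with
  | nil => cases y; rfl
  | cons p q ih =>
    cases y with
    | cons p' q' =>
      have := Ins.unique h ⟨_, q⟩ ⟨_, q'⟩
      cases this
      rw [ih (q.nodup h) p']

theorem Ins.exists_of_mem {a : I} {l : List I} (h : a ∈ l) : ∃ t, Nonempty (Ins a t l) := by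
  induction l with
  | nil => simp at h
  | cons b l ih =>
    by_cases hab : a = b
    · subst hab
      exact ⟨l, ⟨.here l⟩⟩
    · obtain ⟨t, ⟨p⟩⟩ := ih (by simpa [hab] using h)
      exact ⟨b :: t, ⟨.there b p⟩⟩

theorem Ins.perm {a : I} {t l : List I} (p : Ins a t l) : l.Perm (a :: t) := by
  induction p with
  | here t => exact List.Perm.refl _
  | there c p ih => exact (ih.cons c).trans (List.Perm.swap _ _ _)

theorem Match.nonempty_of_perm (s : I → I') (l : List I) :
    ∀ (l' : List I'), (l.map s).Perm l' → Nonempty (Match s l l') := by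
  induction l with
  | nil =>
    intro l' h
    rw [List.map_nil, List.nil_perm] at h
    subst h
    exact ⟨.nil⟩
  | cons a l ih =>
    intro l' h
    obtain ⟨t, ⟨q⟩⟩ := Ins.exists_of_mem (h.subset (by simp) : s a ∈ l')
    have h2 : (s a :: l.map s).Perm (s a :: t) := (List.map_cons (f := s) ▸ h : (s a :: l.map s).Perm l').trans q.perm
    obtain ⟨p⟩ := ih t h2.cons_inv
    exact ⟨.cons p q⟩

theorem Match.nonempty_equiv {r r' : ℕ} (σ : Fin r ≃ Fin r') :
    Nonempty (Match σ (List.finRange r) (List.finRange r')) :=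
  Match.nonempty_of_perm _ _ _ ((List.perm_ext_iff_of_nodup
    ((List.nodup_finRange r).map σ.injective) (List.nodup_finRange r')).2
      (fun a => by simpa using ⟨σ.symm a, by simp⟩))

/-- The identification of `{1, …, r'}` with the reordering of `σ 1, …, σ r` for a bijection `σ`;
there is exactly one since these lists have no repetition (`Match.unique`). -/
noncomputable def Match.ofEquiv {r r' : ℕ} (σ : Fin r ≃ Fin r') :
    Match σ (List.finRange r) (List.finRange r') :=
  (Match.nonempty_equiv σ).some

end

section

variable {C : Type u} [Category.{v} C] [MonoidalCategory C]

/-- The iterated tensor product `X a₁ ⊗ (X a₂ ⊗ (⋯ ⊗ (X aₖ ⊗ 𝟙)))` over a list. -/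
def listTensor {I : Type} (X : I → C) : List I → C
  | [] => 𝟙_ C
  | a :: t => X a ⊗ listTensor X t

variable [SymmetricCategory C]

/-- Exchange of the first two factors. -/
def swapFront (X Y Z : C) : X ⊗ Y ⊗ Z ⟶ Y ⊗ X ⊗ Z :=
  (α_ X Y Z).inv ≫ (β_ X Y).hom ▷ Z ≫ (α_ Y X Z).hom

/-- The symmetry morphism which moves the first factor to its place in the list. -/
def Ins.hom {I : Type} (X : I → C) {a : I} :
    {t l : List I} → Ins a t l → (X a ⊗ listTensor X t ⟶ listTensor X l)
  | _, _, .here _ => 𝟙 _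
  | _, _, .there b p => swapFront (X a) (X b) _ ≫ X b ◁ p.hom X

/-- The morphism between iterated tensor products given by the morphisms `φ a` on the factors,
followed by the symmetry which reorders the factors. -/
def Match.hom {I I' : Type} {s : I → I'} {X : I → C} {X' : I' → C} (φ : ∀ a, X a ⟶ X' (s a)) :
    {l : List I} → {l' : List I'} → Match s l l' → (listTensor X l ⟶ listTensor X' l')
  | _, _, .nil => 𝟙 _
  | _, _, .cons (a := a) p q => (φ a ⊗ₘ p.hom φ) ≫ q.hom X'

/-- The tensor product of the family `X 1, …, X r`. -/
def tensor {r : ℕ} (X : Fin r → C) : C := listTensor X (List.finRange r)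

/-- The morphism `X 1 ⊗ ⋯ ⊗ X r ⟶ X' 1 ⊗ ⋯ ⊗ X' r'` which sends the `i`-th factor to the
`σ i`-th factor through `φ i`. -/
noncomputable def tensorMap {r r' : ℕ} {X : Fin r → C} {X' : Fin r' → C} (σ : Fin r ≃ Fin r')
    (φ : ∀ i, X i ⟶ X' (σ i)) : tensor X ⟶ tensor X' :=
  (Match.ofEquiv σ).hom φ

theorem swapFront_naturality {X X' Y Y' Z Z' : C} (f : X ⟶ X') (g : Y ⟶ Y') (h : Z ⟶ Z') :
    (f ⊗ₘ g ⊗ₘ h) ≫ swapFront X' Y' Z' = swapFront X Y Z ≫ (g ⊗ₘ f ⊗ₘ h) := by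
  simp only [swapFront, Category.assoc]
  rw [associator_inv_naturality_assoc, ← associator_naturality, ← tensorHom_id,
    ← tensorHom_id, tensorHom_comp_tensorHom_assoc, tensorHom_comp_tensorHom_assoc,
    BraidedCategory.braiding_naturality]
  simp

theorem swapFront_swapFront (X Y Z : C) :
    swapFront X Y Z ≫ swapFront Y X Z = 𝟙 _ := by
  simp [swapFront, ← comp_whiskerRight_assoc]

theorem swapFront_yang_baxter (X Y Z W : C) :
    X ◁ swapFront Y Z W ≫ swapFront X Z (Y ⊗ W) ≫ Z ◁ swapFront X Y W =
      swapFront X Y (Z ⊗ W) ≫ Y ◁ swapFront X Z W ≫ swapFront Y Z (X ⊗ W) := by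
  simp only [swapFront]
  calc
    _ = 𝟙 _ ⊗≫ ((X ◁ (β_ Y Z).hom ≫ (α_ X Z Y).inv ≫ (β_ X Z).hom ▷ Y ≫
          (α_ Z X Y).hom ≫ Z ◁ (β_ X Y).hom) ▷ W) ⊗≫ 𝟙 _ := by monoidal
    _ = _ := by
      rw [← BraidedCategory.yang_baxter]
      monoidal

theorem Ins.hom_exchange {I : Type} (X : I → C) {a b : I} {u s l : List I} (p : Ins b s l)
    (q : Ins a u s) : ∃ (t : List I) (q' : Ins a t l) (p' : Ins b u t),
      X b ◁ q.hom X ≫ p.hom X = swapFront (X b) (X a) _ ≫ X a ◁ p'.hom X ≫ q'.hom X := by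
  induction p generalizing u with
  | here s =>
    refine ⟨_, .there b q, .here u, ?_⟩
    simp [Ins.hom, reassoc_of% (swapFront_swapFront (X b) (X a) (listTensor X u)), listTensor]
  | there c p ih =>
    cases q with
    | here =>
      refine ⟨_, .here _, p, ?_⟩
      simp [Ins.hom, listTensor]
    | there _ q =>
      obtain ⟨t, q', p', h⟩ := ih q
      refine ⟨_, .there c q', .there c p', ?_⟩
      have n1 := swapFront_naturality (𝟙 (X b)) (𝟙 (X c)) (q.hom X)
      have n2 := swapFront_naturality (𝟙 (X a)) (𝟙 (X c)) (p'.hom X)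
      simp only [id_tensorHom] at n1 n2
      simp only [Ins.hom, MonoidalCategory.whiskerLeft_comp, Category.assoc, listTensor]
      rw [reassoc_of% n1, reassoc_of% n2, ← MonoidalCategory.whiskerLeft_comp, h]
      simp only [MonoidalCategory.whiskerLeft_comp]
      rw [reassoc_of% (swapFront_yang_baxter (X b) (X a) (X c))]

theorem Match.hom_exchange {I I' : Type} {s : I → I'} {X : I → C} {X' : I' → C}
    (φ : ∀ a, X a ⟶ X' (s a)) {a : I} {t l : List I} {l' : List I'} (q : Ins a t l)
    (p : Match s l l') : ∃ (t' : List I') (q' : Ins (s a) t' l') (p' : Match s t t'),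
      q.hom X ≫ p.hom φ = (φ a ⊗ₘ p'.hom φ) ≫ q'.hom X' := by
  induction q generalizing l' with
  | here t =>
    cases p with
    | cons p q' => exact ⟨_, q', p, by simp [Ins.hom, Match.hom, listTensor]⟩
  | there b q ih =>
    cases p with
    | cons p r =>
      obtain ⟨t1, q1, p1, h1⟩ := ih p
      obtain ⟨t', q', r', h2⟩ := Ins.hom_exchange X' r q1
      refine ⟨t', q', .cons p1 r', ?_⟩
      simp only [Ins.hom, Match.hom, Category.assoc, listTensor]
      rw [whiskerLeft_comp_tensorHom_assoc, h1, ← tensorHom_comp_whiskerLeft_assoc, h2,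
        reassoc_of% (swapFront_naturality (φ b) (φ a) (p1.hom φ)),
        reassoc_of% (swapFront_swapFront (X a) (X b)), tensorHom_comp_whiskerLeft_assoc]

theorem Match.hom_comp {I I' I'' : Type} {s : I → I'} {s' : I' → I''} {X : I → C} {X' : I' → C}
    {X'' : I'' → C} (φ : ∀ a, X a ⟶ X' (s a)) (φ' : ∀ a, X' a ⟶ X'' (s' a))
    {l : List I} {l' : List I'} {l'' : List I''} (p : Match s l l') (q : Match s' l' l'') :
    ∃ r : Match (s' ∘ s) l l'', p.hom φ ≫ q.hom φ' = r.hom (fun a => φ a ≫ φ' (s a)) := by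
  induction p generalizing l'' with
  | nil =>
    cases q with
    | nil => exact ⟨.nil, Category.id_comp _⟩
  | cons p i ih =>
    obtain ⟨t', i', q', h⟩ := Match.hom_exchange φ' i q
    obtain ⟨r, hr⟩ := ih q'
    refine ⟨.cons r i', ?_⟩
    refine (Category.assoc _ _ _).trans ((congrArg (_ ≫ ·) h).trans ?_)
    refine (tensorHom_comp_tensorHom_assoc _ _ _ _ _).trans ?_
    rw [hr]
    rfl

theorem Match.hom_id {I : Type} (X : I → C) (l : List I) :
    ∃ r : Match id l l, r.hom (fun a => 𝟙 (X a)) = 𝟙 (listTensor X l) := by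
  induction l with
  | nil => exact ⟨.nil, rfl⟩
  | cons a l ih =>
    obtain ⟨r, hr⟩ := ih
    refine ⟨.cons r (.here l), ?_⟩
    simp [Match.hom, Ins.hom, listTensor, hr]

theorem tensorMap_comp {r r' r'' : ℕ} {X : Fin r → C} {X' : Fin r' → C} {X'' : Fin r'' → C}
    (σ : Fin r ≃ Fin r') (σ' : Fin r' ≃ Fin r'') (φ : ∀ i, X i ⟶ X' (σ i))
    (φ' : ∀ i, X' i ⟶ X'' (σ' i)) :
    tensorMap σ φ ≫ tensorMap σ' φ' = tensorMap (σ.trans σ') (fun i => φ i ≫ φ' (σ i)) := by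
  obtain ⟨q, hq⟩ := Match.hom_comp φ φ' (Match.ofEquiv σ) (Match.ofEquiv σ')
  have e : q = Match.ofEquiv (σ.trans σ') := Match.unique (List.nodup_finRange _) _ _
  exact hq.trans (by rw [e]; rfl)

theorem tensorMap_id {r : ℕ} (X : Fin r → C) :
    tensorMap (Equiv.refl (Fin r)) (fun i => 𝟙 (X i)) = 𝟙 (tensor X) := by
  obtain ⟨q, hq⟩ := Match.hom_id X (List.finRange r)
  have e : q = Match.ofEquiv (Equiv.refl _) := Match.unique (List.nodup_finRange _) _ _
  exact (by rw [e]; rfl : _ = q.hom _).trans hq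

end

end FamilyTensor

/-! ### Symmetric sequences and their composition product -/

/-- The category of finite sets and bijections. -/
structure FinSet where
  /-- The underlying set. -/
  carrier : Type
  [finite : Finite carrier]

attribute [instance] FinSet.finite

instance : Category FinSet where
  Hom X Y := X.carrier ≃ Y.carrier
  id X := Equiv.refl X.carrier
  comp f g := f.trans g

/-- The bijection underlying a morphism of finite sets. -/
def FinSet.toEquiv {X Y : FinSet} (θ : X ⟶ Y) : X.carrier ≃ Y.carrier := θ

/-- A bijection, as a morphism of finite sets. -/
def FinSet.ofEquiv {X Y : FinSet} (e : X.carrier ≃ Y.carrier) : X ⟶ Y := e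

/-- A symmetric sequence in `C` is a functor from finite sets and bijections to `C`. -/
abbrev SymSeq (C : Type u) [Category.{v} C] := FinSet ⥤ C

namespace SymSeq

/-- The fibre `f⁻¹(i)`, as a finite set. -/
def fiber {J : FinSet} {r : ℕ} (f : J.carrier → Fin r) (i : Fin r) : FinSet where
  carrier := {x : J.carrier // f x = i}

/-- The finite set `{1, …, r}`. -/
def ord (r : ℕ) : FinSet where
  carrier := Fin r

/-- A bijection `{1, …, r} ≃ {1, …, r'}`, as a morphism of finite sets. -/
def ordMap {r r' : ℕ} (σ : Fin r ≃ Fin r') : ord r ⟶ ord r' := FinSet.ofEquiv σ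

/-- The bijection `f⁻¹(i) ≃ f'⁻¹(σ i)` induced by a bijection `θ` with `f' ∘ θ = σ ∘ f`. -/
def fiberMap {J J' : FinSet} {r r' : ℕ} {f : J.carrier → Fin r} {f' : J'.carrier → Fin r'}
    (θ : J ⟶ J') (σ : Fin r ≃ Fin r') (h : ∀ x, f' (FinSet.toEquiv θ x) = σ (f x)) (i : Fin r) :
    fiber f i ⟶ fiber f' (σ i) :=
  FinSet.ofEquiv <| Equiv.subtypeEquiv (FinSet.toEquiv θ) (fun x => by
    have := h x
    constructor
    · intro e
      rw [← e]
      exact this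
    · intro e
      exact σ.injective (this.symm.trans e))

/-- The category `J/FinSet₀`: objects are the maps `f : J → {1, …, r}` (for all `r ≥ 0`), and
morphisms from `f` to `f'` are the bijections `σ` with `f' = σ ∘ f`. -/
structure UnderFin (J : FinSet) where
  /-- The cardinality of the target. -/
  r : ℕ
  /-- The map. -/
  map : J.carrier → Fin r

/-- Morphisms in the category `J/FinSet₀`. -/
@[ext]
structure UnderFin.Hom {J : FinSet} (f f' : UnderFin J) where
  /-- The bijection between the targets. -/
  equiv : Fin f.r ≃ Fin f'.r
  comm : ∀ x, f'.map x = equiv (f.map x)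

instance (J : FinSet) : Category (UnderFin J) where
  Hom f f' := UnderFin.Hom f f'
  id f := ⟨Equiv.refl _, fun _ => rfl⟩
  comp p q := ⟨p.equiv.trans q.equiv, fun x => by rw [q.comm, p.comm]; rfl⟩

theorem UnderFin.Hom.comm_id {J : FinSet} {f f' : UnderFin J} (p : f ⟶ f') (x : J.carrier) :
    f'.map (FinSet.toEquiv (𝟙 J) x) = UnderFin.Hom.equiv p (f.map x) :=
  UnderFin.Hom.comm p x

section

variable {C : Type u} [Category.{v} C] [MonoidalCategory C] [SymmetricCategory C]

/-- The object `(M, N)(f) = M(I) ⊗ ⨂_{i ∈ I} N(f⁻¹(i))` for `f : J → I = {1, …, r}`. -/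
def pairObj (M N : SymSeq C) {J : FinSet} (f : UnderFin J) : C :=
  M.obj (ord f.r) ⊗ FamilyTensor.tensor (fun i => N.obj (fiber f.map i))

/-- The morphism `(M, N)(f) ⟶ (M', N')(f')` induced by morphisms of symmetric sequences
`M ⟶ M'` and `N ⟶ N'`, and by bijections `θ` and `σ` with `f' ∘ θ = σ ∘ f`. It maps the
factor indexed by `i` to the one indexed by `σ i`. -/
noncomputable def pairMap {M M' N N' : SymSeq C} (m : M ⟶ M') (n : N ⟶ N') {J J' : FinSet}
    {f : UnderFin J} {f' : UnderFin J'} (θ : J ⟶ J') (σ : Fin f.r ≃ Fin f'.r)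
    (h : ∀ x, f'.map (FinSet.toEquiv θ x) = σ (f.map x)) :
    pairObj M N f ⟶ pairObj M' N' f' :=
  (m.app (ord f.r) ≫ M'.map (ordMap σ)) ⊗ₘ
    FamilyTensor.tensorMap σ (fun i => n.app (fiber f.map i) ≫ N'.map (fiberMap θ σ h i))

theorem pairMap_id (M N : SymSeq C) {J : FinSet} (f : UnderFin J) :
    pairMap (𝟙 M) (𝟙 N) (𝟙 J) (Equiv.refl _) (fun _ => rfl) = 𝟙 (pairObj M N f) := by
  have h1 : (𝟙 M : M ⟶ M).app (ord f.r) ≫ M.map (ordMap (Equiv.refl (Fin f.r))) = 𝟙 _ :=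
    (Category.id_comp _).trans (M.map_id (ord f.r))
  have h2 : (fun i : Fin f.r => (𝟙 N : N ⟶ N).app (fiber f.map i) ≫
      N.map (fiberMap (𝟙 J) (Equiv.refl (Fin f.r)) (fun _ => rfl) i)) = fun i => 𝟙 _ :=
    funext fun i => (Category.id_comp _).trans (N.map_id (fiber f.map i))
  refine (congrArg₂ (· ⊗ₘ ·) h1 ((congrArg (FamilyTensor.tensorMap (Equiv.refl (Fin f.r))) h2).trans
    (FamilyTensor.tensorMap_id _))).trans ?_
  exact id_tensorHom_id _ _

theorem pairMap_comp {M M' M'' N N' N'' : SymSeq C} (m : M ⟶ M') (n : N ⟶ N') (m' : M' ⟶ M'')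
    (n' : N' ⟶ N'') {J J' J'' : FinSet} {f : UnderFin J} {f' : UnderFin J'} {f'' : UnderFin J''}
    (θ : J ⟶ J') (θ' : J' ⟶ J'') (σ : Fin f.r ≃ Fin f'.r) (σ' : Fin f'.r ≃ Fin f''.r)
    (h : ∀ x, f'.map (FinSet.toEquiv θ x) = σ (f.map x))
    (h' : ∀ x, f''.map (FinSet.toEquiv θ' x) = σ' (f'.map x)) :
    pairMap m n θ σ h ≫ pairMap m' n' θ' σ' h' =
      pairMap (m ≫ m') (n ≫ n') (θ ≫ θ') (σ.trans σ')
        (fun x => (h' _).trans (congrArg σ' (h x))) := by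
  refine (tensorHom_comp_tensorHom _ _ _ _).trans (congrArg₂ (· ⊗ₘ ·) ?_ ?_)
  · have e : ordMap (σ.trans σ') = ordMap σ ≫ ordMap σ' := rfl
    rw [e]
    simp
  · refine (FamilyTensor.tensorMap_comp σ σ' _ _).trans
      (congrArg (FamilyTensor.tensorMap (σ.trans σ')) (funext fun i => ?_))
    have e : fiberMap (θ ≫ θ') (σ.trans σ') (fun x => (h' _).trans (congrArg σ' (h x))) i =
      fiberMap θ σ h i ≫ fiberMap θ' σ' h' (σ i) := rfl
    rw [e]
    simp

theorem pairMap_congr {M M' N N' : SymSeq C} {m m₁ : M ⟶ M'} {n n₁ : N ⟶ N'} {J J' : FinSet}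
    {f : UnderFin J} {f' : UnderFin J'} {θ θ₁ : J ⟶ J'} {σ σ₁ : Fin f.r ≃ Fin f'.r}
    {h : ∀ x, f'.map (FinSet.toEquiv θ x) = σ (f.map x)}
    {h₁ : ∀ x, f'.map (FinSet.toEquiv θ₁ x) = σ₁ (f.map x)}
    (hm : m = m₁) (hn : n = n₁) (hθ : θ = θ₁) (hσ : σ = σ₁) :
    pairMap m n θ σ h = pairMap m₁ n₁ θ₁ σ₁ h₁ := by
  subst hm hn hθ hσ
  rfl

/-- The functor `(M, N) : J/FinSet₀ ⥤ C`. -/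
noncomputable def pairFunctor (M N : SymSeq C) (J : FinSet) : UnderFin J ⥤ C where
  obj f := pairObj M N f
  map p := pairMap (𝟙 M) (𝟙 N) (𝟙 J) (UnderFin.Hom.equiv p) (UnderFin.Hom.comm_id p)
  map_id f := pairMap_id M N f
  map_comp _ _ := Eq.symm <| (pairMap_comp _ _ _ _ _ _ _ _ _ _).trans <|
    pairMap_congr (Category.comp_id _) (Category.comp_id _) (Category.comp_id _) rfl

variable [HasColimits C]

/-- The value `(M ∘ N)(J)`, the colimit of `(M, N)` over `J/FinSet₀`. -/
noncomputable def circObj (M N : SymSeq C) (J : FinSet) : C := colimit (pairFunctor M N J)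

/-- The canonical map `(M, N)(f) ⟶ (M ∘ N)(J)`. -/
noncomputable def circι (M N : SymSeq C) {J : FinSet} (f : UnderFin J) :
    pairObj M N f ⟶ circObj M N J :=
  colimit.ι (pairFunctor M N J) f

theorem circObj_hom_ext {M N : SymSeq C} {J : FinSet} {X : C} {p q : circObj M N J ⟶ X}
    (h : ∀ f : UnderFin J, circι M N f ≫ p = circι M N f ≫ q) : p = q :=
  colimit.hom_ext (F := pairFunctor M N J) h

theorem pairMap_circι (M N : SymSeq C) {J : FinSet} {f g : UnderFin J} (σ : Fin f.r ≃ Fin g.r)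
    (h : ∀ x, g.map (FinSet.toEquiv (𝟙 J) x) = σ (f.map x)) :
    pairMap (𝟙 M) (𝟙 N) (𝟙 J) σ h ≫ circι M N g = circι M N f :=
  colimit.w (pairFunctor M N J) (UnderFin.Hom.mk σ h : f ⟶ g)

/-- The object `f ∘ θ⁻¹` of `J'/FinSet₀`, for `f` in `J/FinSet₀` and a bijection `θ : J ≃ J'`. -/
def UnderFin.push {J J' : FinSet} (θ : J ⟶ J') (f : UnderFin J) : UnderFin J' where
  r := f.r
  map := f.map ∘ (FinSet.toEquiv θ).symm

/-- The objects `f` and `f ∘ θ⁻¹` have the same target. -/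
def UnderFin.pushEquiv {J J' : FinSet} (θ : J ⟶ J') (f : UnderFin J) :
    Fin f.r ≃ Fin (f.push θ).r :=
  Equiv.refl _

theorem UnderFin.push_apply {J J' : FinSet} (θ : J ⟶ J') (f : UnderFin J) (x : J.carrier) :
    (f.push θ).map (FinSet.toEquiv θ x) = f.pushEquiv θ (f.map x) :=
  congrArg f.map (Equiv.symm_apply_apply (FinSet.toEquiv θ) x)

/-- Functoriality of `f ↦ f ∘ θ⁻¹`. -/
def UnderFin.pushMap {J J' : FinSet} (θ : J ⟶ J') {f g : UnderFin J} (p : f ⟶ g) :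
    f.push θ ⟶ g.push θ :=
  UnderFin.Hom.mk (f := f.push θ) (f' := g.push θ) (UnderFin.Hom.equiv (f := f) (f' := g) p)
    (fun x => UnderFin.Hom.comm p ((FinSet.toEquiv θ).symm x))

theorem pairMap_push_circι {M M' N N' : SymSeq C} (m : M ⟶ M') (n : N ⟶ N') {J J' : FinSet}
    (θ : J ⟶ J') {f g : UnderFin J} (p : f ⟶ g) :
    pairMap (𝟙 M) (𝟙 N) (𝟙 J) (UnderFin.Hom.equiv p) (UnderFin.Hom.comm_id p) ≫
        pairMap m n θ (g.pushEquiv θ) (g.push_apply θ) ≫ circι M' N' (g.push θ) =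
      pairMap m n θ (f.pushEquiv θ) (f.push_apply θ) ≫ circι M' N' (f.push θ) := by
  have w := pairMap_circι M' N' (UnderFin.Hom.equiv (UnderFin.pushMap θ p))
    (UnderFin.Hom.comm_id (UnderFin.pushMap θ p))
  refine (Category.assoc _ _ _).symm.trans (Eq.trans ?_
    (congrArg (pairMap m n θ (f.pushEquiv θ) (f.push_apply θ) ≫ ·) w))
  refine Eq.trans (congrArg (· ≫ circι M' N' (g.push θ)) ?_) (Category.assoc _ _ _)
  refine (pairMap_comp _ _ _ _ _ _ _ _ _ _).trans (Eq.trans ?_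
    (pairMap_comp m n (𝟙 M') (𝟙 N') θ (𝟙 J') (f.pushEquiv θ)
      (UnderFin.Hom.equiv (UnderFin.pushMap θ p)) (f.push_apply θ)
      (UnderFin.Hom.comm_id (UnderFin.pushMap θ p))).symm)
  exact pairMap_congr ((Category.id_comp m).trans (Category.comp_id m).symm)
    ((Category.id_comp n).trans (Category.comp_id n).symm)
    ((Category.id_comp θ).trans (Category.comp_id θ).symm) rfl

/-- The map `(M ∘ N)(J) ⟶ (M' ∘ N')(J')` induced by morphisms of symmetric sequences
and a bijection `θ : J ≃ J'`. It maps `(M, N)(f)` to `(M', N')(f ∘ θ⁻¹)`. -/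
noncomputable def circMap {M M' N N' : SymSeq C} (m : M ⟶ M') (n : N ⟶ N') {J J' : FinSet}
    (θ : J ⟶ J') : circObj M N J ⟶ circObj M' N' J' :=
  colimit.desc (pairFunctor M N J)
    { pt := circObj M' N' J'
      ι :=
        { app := fun f =>
            pairMap m n θ (f.pushEquiv θ) (f.push_apply θ) ≫ circι M' N' (f.push θ)
          naturality := fun _ _ p =>
            (pairMap_push_circι m n θ p).trans (Category.comp_id _).symm } }

theorem circι_circMap {M M' N N' : SymSeq C} (m : M ⟶ M') (n : N ⟶ N') {J J' : FinSet}
    (θ : J ⟶ J') (f : UnderFin J) (f' : UnderFin J') (σ : Fin f.r ≃ Fin f'.r)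
    (h : ∀ x, f'.map (FinSet.toEquiv θ x) = σ (f.map x)) :
    circι M N f ≫ circMap m n θ = pairMap m n θ σ h ≫ circι M' N' f' := by
  refine (colimit.ι_desc _ _).trans ?_
  have w := pairMap_circι M' N' (f := f.push θ) (g := f') σ (fun x => by
      have := h ((FinSet.toEquiv θ).symm x)
      rwa [Equiv.apply_symm_apply] at this)
  refine (congrArg (pairMap m n θ (f.pushEquiv θ) (f.push_apply θ) ≫ ·) w.symm).trans ?_
  refine (Category.assoc _ _ _).symm.trans (congrArg (· ≫ circι M' N' f') ?_)
  exact (pairMap_comp _ _ _ _ _ _ _ _ _ _).trans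
    (pairMap_congr (Category.comp_id _) (Category.comp_id _) (Category.comp_id _) rfl)

theorem circMap_id (M N : SymSeq C) (J : FinSet) :
    circMap (𝟙 M) (𝟙 N) (𝟙 J) = 𝟙 (circObj M N J) := by
  refine circObj_hom_ext fun f => ?_
  rw [circι_circMap _ _ _ f f (Equiv.refl _) (fun _ => rfl), pairMap_id]
  exact (Category.id_comp _).trans (Category.comp_id _).symm

theorem circMap_comp {M M' M'' N N' N'' : SymSeq C} (m : M ⟶ M') (n : N ⟶ N') (m' : M' ⟶ M'')
    (n' : N' ⟶ N'') {J J' J'' : FinSet} (θ : J ⟶ J') (θ' : J' ⟶ J'') :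
    circMap m n θ ≫ circMap m' n' θ' = circMap (m ≫ m') (n ≫ n') (θ ≫ θ') := by
  refine circObj_hom_ext fun f => ?_
  rw [← Category.assoc, circι_circMap m n θ f (f.push θ) (f.pushEquiv θ) (f.push_apply θ),
    Category.assoc, circι_circMap m' n' θ' (f.push θ) ((f.push θ).push θ')
      ((f.push θ).pushEquiv θ') ((f.push θ).push_apply θ'), ← Category.assoc, pairMap_comp]
  exact (circι_circMap (m ≫ m') (n ≫ n') (θ ≫ θ') f ((f.push θ).push θ') _ _).symm

/-- The composition product `M ∘ N` of symmetric sequences, as a functor of `M` and `N`. -/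
@[simps]
noncomputable def circ : SymSeq C ⥤ SymSeq C ⥤ SymSeq C where
  obj M :=
    { obj := fun N =>
        { obj := fun J => circObj M N J
          map := fun θ => circMap (𝟙 M) (𝟙 N) θ
          map_id := fun J => circMap_id M N J
          map_comp := fun θ θ' => by rw [circMap_comp]; simp }
      map := fun n =>
        { app := fun J => circMap (𝟙 M) n (𝟙 J)
          naturality := fun J J' θ => by simp [circMap_comp] }
      map_id := fun N => by ext J; exact circMap_id M N J
      map_comp := fun n n' => by ext J; simp [circMap_comp] }
  map m :=
    { app := fun N =>
        { app := fun J => circMap m (𝟙 N) (𝟙 J)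
          naturality := fun J J' θ => by simp [circMap_comp] }
      naturality := fun N N' n => by ext J; simp [circMap_comp] }
  map_id M := by ext N J; exact circMap_id M N J
  map_comp m m' := by ext N J; simp [circMap_comp]

/-- The pushout-corner map `A' ∘ B ⊔_{A ∘ B} A ∘ B' ⟶ A' ∘ B'` of `i : A ⟶ A'` and
`j : B ⟶ B'`. -/
noncomputable def circCorner {A A' B B' : SymSeq C} (i : A ⟶ A') (j : B ⟶ B') :
    pushout ((circ.map i).app B) ((circ.obj A).map j) ⟶ (circ.obj A').obj B' :=
  pushout.desc ((circ.obj A').map j) ((circ.map i).app B') ((circ.map i).naturality j).symm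

end

/-! ### The projective classes of morphisms -/

section

variable {C : Type u} [Category.{v} C] [ModelCategory C]

/-- Weak equivalences of symmetric sequences are objectwise. -/
instance : CategoryWithWeakEquivalences (SymSeq C) where
  weakEquivalences := fun _ _ f => ∀ J, WeakEquivalence (f.app J)

/-- Fibrations of symmetric sequences are objectwise. -/
instance : CategoryWithFibrations (SymSeq C) where
  fibrations := fun _ _ f => ∀ J, Fibration (f.app J)

/-- Cofibrations of symmetric sequences are the morphisms with the left lifting property with
respect to the morphisms which are objectwise trivial fibrations. -/
instance : CategoryWithCofibrations (SymSeq C) where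
  cofibrations := (trivialFibrations (SymSeq C)).llp

end

end SymSeq

/-! ### Model-categorical hypotheses -/

/-- A model category is cofibrantly generated if there are sets `I` and `J` of morphisms which
permit the small object argument, such that the trivial fibrations (resp. the fibrations) are the
morphisms with the right lifting property with respect to `I` (resp. `J`). -/
class CofibrantlyGenerated (C : Type u) [Category.{v} C] [ModelCategory C] : Prop where
  exists_generating_cofibrations : ∃ I : MorphismProperty C,
    MorphismProperty.HasSmallObjectArgument.{v} I ∧ I.rlp = trivialFibrations C
  exists_generating_trivialCofibrations : ∃ J : MorphismProperty C,
    MorphismProperty.HasSmallObjectArgument.{v} J ∧ J.rlp = fibrations C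

/-- The compatibility of a symmetric monoidal structure with a model structure: the tensor product
preserves colimits in each variable (this holds when the monoidal structure is closed), and the
pushout-product axiom holds. No condition on the unit object is imposed. -/
class SymmetricMonoidalModel (C : Type u) [Category.{v} C] [MonoidalCategory C]
    [SymmetricCategory C] [ModelCategory C] : Prop where
  preservesColimits_tensorLeft (X : C) : PreservesColimits (tensorLeft X)
  preservesColimits_tensorRight (X : C) : PreservesColimits (tensorRight X)
  pushout_product {K K' L L' : C} (f : K ⟶ K') (g : L ⟶ L') (hf : Cofibration f)
    (hg : Cofibration g) :
    Cofibration (pushout.desc (K' ◁ g) (f ▷ L') (whisker_exchange f g).symm :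
      pushout (f ▷ L) (K ◁ g) ⟶ K' ⊗ L')
  pushout_product_trivial {K K' L L' : C} (f : K ⟶ K') (g : L ⟶ L') (hf : Cofibration f)
    (hg : Cofibration g) (hfg : WeakEquivalence f ∨ WeakEquivalence g) :
    WeakEquivalence (pushout.desc (K' ◁ g) (f ▷ L') (whisker_exchange f g).symm :
      pushout (f ▷ L) (K ◁ g) ⟶ K' ⊗ L')

-- For a free symmetric sequence `F_r(K)` on an object `K` in degree `r`, the composition product
-- loses its quotient by the symmetric group: `(F_r(K) ∘ N)(J)` is the coproduct over all maps `f :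
-- J → {1, …, r}` of `K ⊗ N(f⁻¹(1)) ⊗ ⋯ ⊗ N(f⁻¹(r))`, that is, `K` times the `r`-fold Day
-- convolution power of `N`. Projective cofibrations are generated by the `F_r(k)` with `k` a
-- cofibration, and `M ↦ M ∘ N` preserves colimits, so `i` may be taken to be `F_r(k)`. The power of
-- `j` is then changed one factor at a time from `B` to `B'`. Each change is a pushout-product of
-- `k`, of `j` and of the objects `B` or `B'` in the other factors. Cofibrancy of these objects and
-- the pushout-product axiom, applied after replacing each factor by a free sequence, give the
-- claim. No hypothesis on the values at the empty set enters, since the reordering group of the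
-- factors acts freely on the generator of `M`.
--
-- The argument is phrased entirely through lifting problems. `CornerLift` expresses that a corner
-- map lifts against `x` without forming the pushout, and `hasLiftingProperty_natArrowHat_iff` turns
-- it into an ordinary lifting property in a category of arrows. Statements about two variables thus
-- reduce to generators one variable at a time.
--
-- The reduction to generators is `hasLiftingProperty_twist`: for diagrams of the form `o ↦
-- Θ(A(π(o)))(o)`, replacing `A` by a free sequence `F_r(K)` amounts to restricting to the category
-- of structured arrows `{1, …, r} ⟶ π(o)`, with `K` as a constant argument. Since maps out of `M ∘
-- N` are maps of diagrams over the groupoid `FinMap` of maps of finite sets (`circ_hom_ext`,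
-- `exists_circRestrict_eq`), this treats first `M`, where labelling the target makes the fibres
-- into `r` independent finite sets, and then each factor `N(f⁻¹(i))`. Once every factor is
-- labelled, the indexing category has an initial object (`rigid_fiberFunctor`), and lifting against
-- a diagram becomes lifting in `C` at that object. `cornerLift_listTwist` carries out the induction
-- over the factors.
--
-- A Boolean records triviality: `false` for cofibrations and `true` for trivial cofibrations, so
-- that `a || b` covers both halves of the theorem at once.

universe w v' u' v'' u''

/-! ### Saturated classes and colimit-preserving functors -/

namespace CategoryTheory.MorphismProperty

variable {C : Type u} [Category.{v} C]

/-- Membership in `coproducts` in terms of cofans. -/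
lemma coproducts_iff_cofan (W : MorphismProperty C) {X Y : C} (f : X ⟶ Y) :
    coproducts.{w} W f ↔ ∃ (J : Type w) (A B : J → C) (a : ∀ j, A j ⟶ X) (b : ∀ j, B j ⟶ Y)
      (φ : ∀ j, A j ⟶ B j), Nonempty (IsColimit (Cofan.mk X a)) ∧
        Nonempty (IsColimit (Cofan.mk Y b)) ∧ (∀ j, W (φ j)) ∧ ∀ j, a j ≫ f = φ j ≫ b j := by
  rw [coproducts_iff]
  constructor
  · rintro ⟨J, ⟨X₁, X₂, c₁, c₂, h₁, h₂, φ, hφ⟩⟩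
    refine ⟨J, fun j => X₁.obj ⟨j⟩, fun j => X₂.obj ⟨j⟩, fun j => c₁.ι.app ⟨j⟩,
      fun j => c₂.ι.app ⟨j⟩, fun j => φ.app ⟨j⟩, ⟨?_⟩, ⟨?_⟩, fun j => hφ _, fun j => ?_⟩
    · exact (IsColimit.precomposeHomEquiv (Discrete.natIso (fun ⟨i⟩ ↦ Iso.refl _)) _).1
          (IsColimit.ofIsoColimit h₁ (Cocone.ext (Iso.refl _) (by simp)))
    · exact (IsColimit.precomposeHomEquiv (Discrete.natIso (fun ⟨i⟩ ↦ Iso.refl _)) _).1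
          (IsColimit.ofIsoColimit h₂ (Cocone.ext (Iso.refl _) (by simp)))
    · exact h₁.fac _ _
  · rintro ⟨J, A, B, a, b, φ, ⟨h₁⟩, ⟨h₂⟩, hφ, fac⟩
    exact ⟨J, .mk' _ _ _ _ h₁ h₂ (Discrete.natTrans fun ⟨j⟩ => φ j) (fun ⟨j⟩ => hφ j) f
      (fun ⟨j⟩ => fac j)⟩

/-- A coproduct of coproducts is a coproduct over the sigma type. This is needed because evaluation
turns a coproduct of free morphisms into such an iterated coproduct. -/
instance (W : MorphismProperty C) : IsStableUnderCoproducts.{w} (coproducts.{w} W) where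
  isStableUnderCoproductsOfShape J := by
    refine (isStableUnderColimitsOfShape_iff_colimitsOfShape_le _ _).2 ?_
    intro X Y f hf
    obtain ⟨J, A, B, a, b, φ, ⟨h₁⟩, ⟨h₂⟩, hφ, fac⟩ := (coproducts_iff_cofan.{v, u, w} _ _).1
      ((coproducts.{w} W).colimitsOfShape_le_coproducts J _ hf)
    have hφ' := fun j => (coproducts_iff_cofan.{v, u, w} _ _).1 (hφ j)
    choose K A' B' a' b' φ' h₁' h₂' hφ' fac' using hφ'
    refine (coproducts_iff_cofan.{v, u, w} _ _).2 ⟨Σ j, K j, fun x => A' x.1 x.2, fun x => B' x.1 x.2,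
      fun x => a' x.1 x.2 ≫ a x.1, fun x => b' x.1 x.2 ≫ b x.1, fun x => φ' x.1 x.2,
      ⟨Cofan.isColimitTrans _ h₁ _ fun j => (h₁' j).some⟩,
      ⟨Cofan.isColimitTrans _ h₂ _ fun j => (h₂' j).some⟩, fun x => hφ' _ _, fun x => ?_⟩
    rw [Category.assoc, fac, ← Category.assoc, fac', Category.assoc]

/-- A colimit-preserving functor sends the saturation of a class of morphisms which permits the
small object argument to any class of the form `W.llp` as soon as it does so for the class. -/
lemma map_mem_llp_of_hasSmallObjectArgument {D : Type u'} [Category.{v'} D]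
    (I : MorphismProperty C) [HasSmallObjectArgument.{w} I] (W : MorphismProperty D) (F : C ⥤ D)
    [PreservesColimitsOfSize.{w, w} F] (hF : I ≤ W.llp.inverseImage F) {X Y : C} (f : X ⟶ Y)
    (hf : I.rlp.llp f) : W.llp (F.map f) := by
  have h1 : coproducts.{w} I ≤ W.llp.inverseImage F := by
    intro X Y f hf
    rw [coproducts_iff] at hf
    obtain ⟨J, ⟨X₁, X₂, c₁, c₂, h₁, h₂, φ, hφ⟩⟩ := hf
    exact colimitsOfShape_le (W := W.llp) (J := Discrete J) _ (colimitsOfShape.mk' (X₁ ⋙ F) (X₂ ⋙ F) _ _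
      (isColimitOfPreserves F h₁) (isColimitOfPreserves F h₂) (Functor.whiskerRight φ F)
      (fun j => hF _ (hφ j)) _ (fun j => by
        have := h₁.fac (Cocone.mk _ (φ ≫ c₂.ι)) j
        dsimp at this ⊢
        rw [← F.map_comp, this, F.map_comp]))
  have h2 : (coproducts.{w} I).pushouts ≤ W.llp.inverseImage F := by
    rintro X Y f ⟨_, _, _, _, _, h, sq⟩
    have : PreservesColimitsOfSize.{0, 0} F := preservesColimitsOfSize_shrink F
    exact W.llp.of_isPushout (sq.map F) (h1 _ h)
  -- The small object argument exhibits `f` as a retract of a transfinite composition of pushouts of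
  -- coproducts from `I`. The functor preserves each of these operations and `W.llp` is closed under
  -- them.
  rw [llp_rlp_of_hasSmallObjectArgument.{w}] at hf
  obtain ⟨X', Y', g, r, hg⟩ := hf
  refine of_retract (r.map F) ?_
  rw [transfiniteCompositions_iff] at hg
  obtain ⟨J, _, _, _, _, ⟨hg⟩⟩ := hg
  have : PreservesWellOrderContinuousOfShape J F := ⟨fun _ _ => inferInstance⟩
  exact transfiniteCompositionsOfShape_le _ J _ ⟨(hg.ofLE h2).map⟩

end CategoryTheory.MorphismProperty

/-! ### Free symmetric sequences and the small object argument -/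

namespace SymSeq

instance (X Y : FinSet) : Finite (X ⟶ Y) := inferInstanceAs (Finite (X.carrier ≃ Y.carrier))

lemma exists_iso_ord (X : FinSet) : ∃ r, Nonempty (X ≅ ord r) := by
  obtain ⟨r, ⟨e⟩⟩ := Finite.exists_equiv_fin X.carrier
  exact ⟨r, ⟨⟨FinSet.ofEquiv e, FinSet.ofEquiv (Y := X) e.symm, Equiv.self_trans_symm e,
    Equiv.symm_trans_self e⟩⟩⟩

section

variable {C : Type u} [Category.{v} C]

/-- `FinSet` is a large category, so natural transformations live in a larger universe. They are
determined by their components at the sets `{1, …, r}`, hence form a small set, as the small object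
argument requires. -/
instance : LocallySmall.{v} (SymSeq C) where
  hom_small X Y := by
    refine small_of_injective (β := ∀ r : ℕ, X.obj (ord r) ⟶ Y.obj (ord r))
      (f := fun f r => f.app (ord r)) fun f g h => ?_
    ext J
    obtain ⟨r, ⟨e⟩⟩ := exists_iso_ord J
    rw [← cancel_mono (Y.map e.hom), ← f.naturality, ← g.naturality]
    exact congrArg (X.map e.hom ≫ ·) (congrFun h r)

variable [HasColimits C]

/-- The free symmetric sequence on an object placed in degree `r`. -/
noncomputable abbrev free (r : ℕ) : C ⥤ SymSeq C := evaluationLeftAdjoint C (ord r)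

/-- The free symmetric sequence functor is left adjoint to evaluation. -/
noncomputable abbrev freeAdj (r : ℕ) : free (C := C) r ⊣ (evaluation FinSet C).obj (ord r) :=
  evaluationAdjunctionRight C (ord r)

/-- The free morphisms of symmetric sequences on the morphisms of a class `I`. -/
noncomputable def freeHoms (I : MorphismProperty C) : MorphismProperty (SymSeq C) :=
  .ofHoms fun p : ℕ × I.toSet => (free p.1).map p.2.1.hom

lemma freeHoms_map (I : MorphismProperty C) (r : ℕ) {A B : C} (f : A ⟶ B) (hf : I f) :
    freeHoms I ((free r).map f) :=
  MorphismProperty.ofHoms.mk (f := fun p : ℕ × I.toSet => (free p.1).map p.2.1.hom)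
    (r, ⟨Arrow.mk f, hf⟩)

/-- By adjunction, lifting against a free morphism in degree `r` is lifting at `{1, …, r}`, and
every finite set is isomorphic to one of these. -/
lemma freeHoms_rlp (I : MorphismProperty C) :
    (freeHoms I).rlp = I.rlp.functorCategory FinSet := by
  ext X Y p
  constructor
  · intro hp J
    obtain ⟨r, ⟨e⟩⟩ := exists_iso_ord J
    refine (I.rlp.arrow_mk_iso_iff (Arrow.isoMk (X.mapIso e) (Y.mapIso e)
      (p.naturality _))).2 (?_ : I.rlp (p.app (ord r)))
    intro A B f hf
    exact ((freeAdj r).hasLiftingProperty_iff f p).1 (hp _ (freeHoms_map I r f hf))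
  · rintro hp _ _ _ ⟨r, f⟩
    exact ((freeAdj r).hasLiftingProperty_iff f.1.hom p).2 (hp _ _ f.2)

/-- The value of a free morphism at `J` is a coproduct of copies of the given morphism, one for each
bijection `ord r ⟶ J`. -/
lemma freeHoms_app_mem_coproducts (I : MorphismProperty C) {A B : SymSeq C} (f : A ⟶ B)
    (hf : freeHoms I f) (J : FinSet) : MorphismProperty.coproducts.{w} I (f.app J) := by
  obtain ⟨r, f⟩ := hf
  exact MorphismProperty.coproducts_of_small _ _ (.mk' _ _ _ _
    (coproductIsCoproduct fun _ : ord r ⟶ J => f.1.left)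
    (coproductIsCoproduct fun _ : ord r ⟶ J => f.1.right)
    (Discrete.natTrans fun _ => f.1.hom) (fun _ => f.2) _ fun j => by simp)

lemma app_mem_pushouts_coproducts (I : MorphismProperty C) {A B : SymSeq C} (f : A ⟶ B)
    (hf : (MorphismProperty.coproducts.{v} (freeHoms I)).pushouts f) (J : FinSet) :
    (MorphismProperty.coproducts.{v} I).pushouts (f.app J) := by
  obtain ⟨A', B', _, _, g, hg, sq⟩ := hf
  refine ⟨_, _, _, _, _, ?_, sq.map ((evaluation FinSet C).obj J)⟩
  rw [MorphismProperty.coproducts_iff] at hg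
  obtain ⟨K, ⟨X₁, X₂, c₁, c₂, h₁, h₂, φ, hφ⟩⟩ := hg
  exact MorphismProperty.colimitsOfShape_le (W := MorphismProperty.coproducts.{v} I)
    (J := Discrete K) _
    (.mk' _ _ _ _
      (isColimitOfPreserves ((evaluation FinSet C).obj J) h₁)
      (isColimitOfPreserves ((evaluation FinSet C).obj J) h₂)
      (Functor.whiskerRight φ ((evaluation FinSet C).obj J))
      (fun j => freeHoms_app_mem_coproducts I _ (hφ j) J) _
      (fun j => congrArg (fun f => f.app J) (h₁.fac (Cocone.mk _ (φ ≫ c₂.ι)) j)))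

/-- Evaluation of a relative cell complex for `freeHoms I` is a relative cell complex for `I`. -/
noncomputable def relativeCellComplexApp (I : MorphismProperty C) {K : Type v} [LinearOrder K]
    [OrderBot K] [SuccOrder K] [WellFoundedLT K] {A B : SymSeq C} {f : A ⟶ B}
    (hf : RelativeCellComplex.{v} (fun _ : K => (freeHoms I).homFamily) f) (J : FinSet) :
    RelativeCellComplex.{v} (fun _ : K => I.homFamily) (f.app J) where
  toTransfiniteCompositionOfShape :=
    haveI : PreservesWellOrderContinuousOfShape K ((evaluation FinSet C).obj J) :=
      ⟨fun _ _ => inferInstance⟩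
    hf.toTransfiniteCompositionOfShape.map ((evaluation FinSet C).obj J)
  attachCells j hj := by
    refine Nonempty.some ?_
    rw [nonempty_attachCells_iff, MorphismProperty.ofHoms_homFamily]
    refine app_mem_pushouts_coproducts I _ ?_ J
    have := (hf.attachCells j hj).pushouts_coproducts
    rwa [MorphismProperty.ofHoms_homFamily] at this

/-- Morphisms from a free symmetric sequence. -/
noncomputable def coyonedaFreeIso (r : ℕ) (A : C) :
    coyoneda.obj (Opposite.op ((free r).obj A)) ≅
      (evaluation FinSet C).obj (ord r) ⋙ coyoneda.obj (Opposite.op A) ⋙ uliftFunctor.{1} :=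
  NatIso.ofComponents (fun X => (((freeAdj r).homEquiv A X).trans Equiv.ulift.symm).toIso)
    (fun f => by
      ext g
      exact congrArg ULift.up ((freeAdj r).homEquiv_naturality_right g f))

/-- Maps out of a free sequence on `A` are maps from `A` into the value at `{1, …, r}`, and
evaluating a cell complex of free morphisms gives a cell complex of `I`. Smallness relative to cell
complexes therefore passes from `I` to the free morphisms, with the same cardinal. -/
instance (I : MorphismProperty C) [MorphismProperty.HasSmallObjectArgument.{v} I] :
    MorphismProperty.HasSmallObjectArgument.{v} (freeHoms I) where
  exists_cardinal := by
    obtain ⟨κ, _, _, _⟩ := MorphismProperty.HasSmallObjectArgument.exists_cardinal (I := I)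
    refine ⟨κ, inferInstance, inferInstance,
    { isSmall := by
        have := SmallObject.isSmall I κ
        unfold freeHoms
        infer_instance
      preservesColimit := by
        rintro _ _ X Y _ ⟨r, f⟩ g hg
        have := SmallObject.preservesColimit I κ _ f.2 _
          (relativeCellComplexApp I hg (ord r))
        have : PreservesColimit (hg.F ⋙ (evaluation FinSet C).obj (ord r))
          (coyoneda.obj (Opposite.op f.1.left)) := this
        exact preservesColimit_of_natIso _ (coyonedaFreeIso r f.1.left).symm }⟩

end

end SymSeq

/-! ### Projective cofibrations and projective trivial cofibrations -/

namespace SymSeq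

variable {C : Type u} [Category.{v} C] [ModelCategory C]

variable (C) in
/-- The trivial fibrations (for `false`) or all the fibrations (for `true`). -/
def fibClass : Bool → MorphismProperty C
  | false => trivialFibrations C
  | true => fibrations C

variable (C) in
/-- The cofibrations (for `false`) or the trivial cofibrations (for `true`). -/
abbrev cofClass (a : Bool) : MorphismProperty C := (fibClass C a).llp

variable (C) in
/-- The morphisms of functors which are objectwise in `fibClass C a`. -/
abbrev objFib (a : Bool) (O : Type u') [Category.{v'} O] : MorphismProperty (O ⥤ C) :=
  (fibClass C a).functorCategory O

variable (C) in
/-- The projective cofibrations (for `false`) or projective trivial cofibrations (for `true`)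
of symmetric sequences. -/
abbrev projCof (a : Bool) : MorphismProperty (SymSeq C) := (objFib C a FinSet).llp

lemma cofClass_false : cofClass C false = cofibrations C := trivialFibrations_llp C

lemma cofClass_true : cofClass C true = trivialCofibrations C := fibrations_llp C

lemma trivialFibrations_eq : trivialFibrations (SymSeq C) = objFib C false FinSet := by
  ext X Y f
  have h1 : fibrations (SymSeq C) f ↔ ∀ J, Fibration (f.app J) := Iff.rfl
  have h2 : weakEquivalences (SymSeq C) f ↔ ∀ J, WeakEquivalence (f.app J) := Iff.rfl
  have h3 : objFib C false FinSet f ↔ ∀ J, trivialFibrations C (f.app J) := Iff.rfl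
  rw [mem_trivialFibrations_iff, h3]
  simp only [mem_trivialFibrations_iff, fibration_iff (f : X ⟶ Y), weakEquivalence_iff (f : X ⟶ Y),
    h1, h2, forall_and]

lemma cofibration_iff_projCof {A B : SymSeq C} (i : A ⟶ B) :
    Cofibration i ↔ projCof C false i := by
  rw [cofibration_iff, projCof, ← trivialFibrations_eq]
  rfl

lemma weakEquivalence_iff_app {A B : SymSeq C} (i : A ⟶ B) :
    WeakEquivalence i ↔ ∀ J, WeakEquivalence (i.app J) := by
  rw [weakEquivalence_iff]
  rfl

/-- Projective trivial cofibrations are objectwise trivial cofibrations. -/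
lemma trivialCofibrations_app_of_projCof {A B : SymSeq C} (i : A ⟶ B) (hi : projCof C true i)
    (J : FinSet) : trivialCofibrations C (i.app J) := by
  rw [← cofClass_true]
  intro X Y p hp
  -- Evaluation at `J` has a right adjoint, sending `X` to `K ↦ ∏_{K ⟶ J} X`. It takes fibrations to
  -- objectwise fibrations because products of fibrations are fibrations.
  refine ((evaluationAdjunctionLeft C J).hasLiftingProperty_iff i p).2 (hi _ fun K => ?_)
  refine MorphismProperty.limitsOfShape_le (W := fibrations C) (J := Discrete (K ⟶ J)) _
    (.mk' _ _ _ _ (productIsProduct fun _ : K ⟶ J => X)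
    (productIsProduct fun _ : K ⟶ J => Y) (Discrete.natTrans fun _ => p) (fun _ => hp) _
    fun j => by simp)

lemma weakEquivalence_of_projCof_true {A B : SymSeq C} (i : A ⟶ B) (hi : projCof C true i) :
    WeakEquivalence i := by
  rw [weakEquivalence_iff_app]
  intro J
  rw [weakEquivalence_iff]
  exact (trivialCofibrations_app_of_projCof i hi J).2

lemma exists_generators [CofibrantlyGenerated C] (a : Bool) : ∃ I : MorphismProperty C,
    MorphismProperty.HasSmallObjectArgument.{v} I ∧ I.rlp = fibClass C a := by
  cases a
  · exact CofibrantlyGenerated.exists_generating_cofibrations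
  · exact CofibrantlyGenerated.exists_generating_trivialCofibrations

variable [HasColimits C] [CofibrantlyGenerated C]

/-- To show that a colimit-preserving functor sends projective (trivial) cofibrations to
`W.llp`, it suffices to consider free morphisms. -/
lemma map_mem_llp_of_free (a : Bool) {E : Type u'} [Category.{v'} E] (W : MorphismProperty E)
    (F : SymSeq C ⥤ E) [PreservesColimitsOfSize.{v, v} F]
    (hF : ∀ (r : ℕ) {K K' : C} (k : K ⟶ K'), cofClass C a k → W.llp (F.map ((free r).map k)))
    {A A' : SymSeq C} (i : A ⟶ A') (hi : projCof C a i) : W.llp (F.map i) := by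
  obtain ⟨I, _, hI⟩ := exists_generators (C := C) a
  refine MorphismProperty.map_mem_llp_of_hasSmallObjectArgument (freeHoms I) W F ?_ i ?_
  · rintro _ _ _ ⟨r, f⟩
    refine hF r _ ?_
    rw [cofClass, ← hI]
    exact MorphismProperty.le_llp_rlp _ _ f.2
  · rwa [freeHoms_rlp, hI]

/-- A cofibration which is a weak equivalence is a projective trivial cofibration. -/
lemma projCof_true_of_weakEquivalence {A B : SymSeq C} (i : A ⟶ B) (hi : Cofibration i)
    (hi' : WeakEquivalence i) : projCof C true i := by
  obtain ⟨I, _, hI⟩ := exists_generators (C := C) true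
  have e : (freeHoms I).rlp = objFib C true FinSet := by rw [freeHoms_rlp, hI]
  have : MorphismProperty.HasFactorization (projCof C true) (objFib C true FinSet) := by
    rw [projCof, ← e]
    infer_instance
  let d := MorphismProperty.factorizationData (projCof C true) (objFib C true FinSet) i
  have h1 := fun J => trivialCofibrations_app_of_projCof d.i d.hi J
  rw [weakEquivalence_iff_app] at hi'
  -- By two out of three the second factor is objectwise a trivial fibration, so `i` lifts against
  -- it and is a retract of the first factor.
  have hp : objFib C false FinSet d.p := fun J => by
    refine ⟨d.hp J, (weakEquivalences C).of_precomp _ _ (h1 J).2 ?_⟩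
    rw [← NatTrans.comp_app, d.fac, ← weakEquivalence_iff]
    exact hi' J
  have := (cofibration_iff_projCof i).1 hi _ hp
  exact MorphismProperty.of_retract (RetractArrow.ofLeftLiftingProperty d.fac) d.hi

end SymSeq

/-! ### Corner lifting properties as lifting properties between arrows -/

namespace CategoryTheory

section

variable {E : Type u'} [Category.{v'} E]

/-- The lifting property, with respect to `x`, of the corner map of the commutative square
with sides `f₁`, `f₂`, `g₁`, `g₂`. -/
def CornerLift {P Q₁ Q₂ Q X Y : E} (f₁ : P ⟶ Q₁) (f₂ : P ⟶ Q₂) (g₁ : Q₁ ⟶ Q) (g₂ : Q₂ ⟶ Q)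
    (x : X ⟶ Y) : Prop :=
  ∀ (u : Q₁ ⟶ X) (v : Q₂ ⟶ X) (t : Q ⟶ Y), f₁ ≫ u = f₂ ≫ v → u ≫ x = g₁ ≫ t → v ≫ x = g₂ ≫ t →
    ∃ d : Q ⟶ X, g₁ ≫ d = u ∧ g₂ ≫ d = v ∧ d ≫ x = t

lemma hasLiftingProperty_iff_exists {A B X Y : E} (i : A ⟶ B) (p : X ⟶ Y) :
    HasLiftingProperty i p ↔ ∀ (u : A ⟶ X) (t : B ⟶ Y), u ≫ p = i ≫ t →
      ∃ d : B ⟶ X, i ≫ d = u ∧ d ≫ p = t := by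
  constructor
  · intro h u t e
    have sq : CommSq u i p t := ⟨e⟩
    exact ⟨sq.lift, sq.fac_left, sq.fac_right⟩
  · intro h
    exact ⟨fun {u t} sq => by
      obtain ⟨d, h1, h2⟩ := h u t sq.w
      exact ⟨⟨⟨d, h1, h2⟩⟩⟩⟩

/-- Horizontal pasting of squares with the corner lifting property. -/
lemma CornerLift.paste {P M Q₁ P' M' Q X Y : E} {f : P ⟶ M} {f' : M ⟶ Q₁} {p : P ⟶ P'}
    {m : M ⟶ M'} {q : Q₁ ⟶ Q} {g : P' ⟶ M'} {g' : M' ⟶ Q} {x : X ⟶ Y} (h : m ≫ g' = f' ≫ q)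
    (h₁ : CornerLift f p m g x) (h₂ : CornerLift f' m q g' x) :
    CornerLift (f ≫ f') p q (g ≫ g') x := by
  intro u v t e1 e2 e3
  obtain ⟨d₁, hd1, hd2, hd3⟩ := h₁ (f' ≫ u) v (g' ≫ t) (by simpa using e1)
    (by rw [Category.assoc, e2, ← Category.assoc, ← h, Category.assoc]) (by simpa using e3)
  obtain ⟨d, hd4, hd5, hd6⟩ := h₂ u d₁ t hd1.symm e2 hd3
  exact ⟨d, hd4, by rw [Category.assoc, hd5, hd2], hd6⟩

lemma CornerLift.of_pushout {P Q₁ Q₂ Q X Y : E} {f₁ : P ⟶ Q₁} {f₂ : P ⟶ Q₂} {g₁ : Q₁ ⟶ Q}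
    {g₂ : Q₂ ⟶ Q} {Z : E} {i₁ : Q₁ ⟶ Z} {i₂ : Q₂ ⟶ Z} (sq : IsPushout f₁ f₂ i₁ i₂) {c : Z ⟶ Q}
    (h₁ : i₁ ≫ c = g₁) (h₂ : i₂ ≫ c = g₂) {x : X ⟶ Y} (hc : HasLiftingProperty c x) :
    CornerLift f₁ f₂ g₁ g₂ x := by
  intro u v t e1 e2 e3
  obtain ⟨d, hd1, hd2⟩ := (hasLiftingProperty_iff_exists _ _).1 hc (sq.desc u v e1) t
    (sq.hom_ext (by simp [e2, ← h₁]) (by simp [e3, ← h₂]))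
  exact ⟨d, by simp [← h₁, hd1], by simp [← h₂, hd1], hd2⟩

lemma CornerLift.hasLiftingProperty_of_pushout {P Q₁ Q₂ Q X Y : E} {f₁ : P ⟶ Q₁} {f₂ : P ⟶ Q₂}
    {g₁ : Q₁ ⟶ Q} {g₂ : Q₂ ⟶ Q} {Z : E} {i₁ : Q₁ ⟶ Z} {i₂ : Q₂ ⟶ Z}
    (sq : IsPushout f₁ f₂ i₁ i₂) {c : Z ⟶ Q}
    (h₁ : i₁ ≫ c = g₁) (h₂ : i₂ ≫ c = g₂) {x : X ⟶ Y} (hc : CornerLift f₁ f₂ g₁ g₂ x) :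
    HasLiftingProperty c x := by
  rw [hasLiftingProperty_iff_exists]
  intro u t e
  obtain ⟨d, hd1, hd2, hd3⟩ := hc (i₁ ≫ u) (i₂ ≫ u) t (by rw [sq.w_assoc])
    (by rw [Category.assoc, e, ← h₁, Category.assoc])
    (by rw [Category.assoc, e, ← h₂, Category.assoc])
  exact ⟨d, sq.hom_ext (by rw [← hd1, ← h₁, Category.assoc])
    (by rw [← hd2, ← h₂, Category.assoc]), hd3⟩

/-- If the left column of a square consists of initial objects, its corner map is the right
column. -/
lemma CornerLift.hasLiftingProperty_of_isInitial {P Q₁ Q₂ Q X Y : E} {f₁ : P ⟶ Q₁} {f₂ : P ⟶ Q₂}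
    {g₁ : Q₁ ⟶ Q} {g₂ : Q₂ ⟶ Q} {x : X ⟶ Y} (hP : IsInitial P) (hQ : IsInitial Q₂)
    (h : CornerLift f₁ f₂ g₁ g₂ x) : HasLiftingProperty g₁ x := by
  rw [hasLiftingProperty_iff_exists]
  intro u t e
  obtain ⟨d, hd1, _, hd3⟩ := h u (hQ.to X) t (hP.hom_ext _ _) e (hQ.hom_ext _ _)
  exact ⟨d, hd1, hd3⟩

lemma CornerLift.of_iso {P Q₁ Q₂ Q P' Q₁' Q₂' Q' X Y : E} {f₁ : P ⟶ Q₁} {f₂ : P ⟶ Q₂}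
    {g₁ : Q₁ ⟶ Q} {g₂ : Q₂ ⟶ Q} {f₁' : P' ⟶ Q₁'} {f₂' : P' ⟶ Q₂'}
    {g₁' : Q₁' ⟶ Q'} {g₂' : Q₂' ⟶ Q'} {x : X ⟶ Y} (a : P ≅ P') (b₁ : Q₁ ≅ Q₁') (b₂ : Q₂ ≅ Q₂')
    (c : Q ≅ Q') (h₁ : f₁ ≫ b₁.hom = a.hom ≫ f₁') (h₂ : f₂ ≫ b₂.hom = a.hom ≫ f₂')
    (h₃ : g₁ ≫ c.hom = b₁.hom ≫ g₁') (h₄ : g₂ ≫ c.hom = b₂.hom ≫ g₂')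
    (h : CornerLift f₁' f₂' g₁' g₂' x) : CornerLift f₁ f₂ g₁ g₂ x := by
  intro u v t e1 e2 e3
  obtain ⟨d, hd1, hd2, hd3⟩ := h (b₁.inv ≫ u) (b₂.inv ≫ v) (c.inv ≫ t)
    (by rw [← cancel_epi a.hom, ← reassoc_of% h₁, ← reassoc_of% h₂]; simpa using e1)
    (by rw [← cancel_epi b₁.hom, ← reassoc_of% h₃]; simpa using e2)
    (by rw [← cancel_epi b₂.hom, ← reassoc_of% h₄]; simpa using e3)
  exact ⟨c.hom ≫ d, by rw [reassoc_of% h₃, hd1]; simp, by rw [reassoc_of% h₄, hd2]; simp,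
    by rw [Category.assoc, hd3]; simp⟩

/-- A functor to an arrow category preserves colimits if its two components do. -/
lemma preservesColimitsOfSize_arrow {A : Type u''} [Category.{v''} A] (F : A ⥤ Arrow E)
    [PreservesColimitsOfSize.{w, w} (F ⋙ Arrow.leftFunc)]
    [PreservesColimitsOfSize.{w, w} (F ⋙ Arrow.rightFunc)] : PreservesColimitsOfSize.{w, w} F where
  preservesColimitsOfShape := ⟨⟨fun hc => ⟨Comma.fstSndJointlyReflectColimit
    (isColimitOfPreserves (F ⋙ Arrow.leftFunc) hc)
    (isColimitOfPreserves (F ⋙ Arrow.rightFunc) hc)⟩⟩⟩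

end

section

variable {O : Type u''} [Category.{v''} O] {D : Type u'} [Category.{v'} D]

/-- A natural transformation, as a functor to the category of arrows. -/
@[simps]
def natArrow {P Q : O ⥤ D} (α : P ⟶ Q) : O ⥤ Arrow D where
  obj o := Arrow.mk (α.app o)
  map h := Arrow.homMk (P.map h) (Q.map h) (α.naturality h)

/-- A commutative square of natural transformations, as a morphism of functors to the category
of arrows. -/
@[simps]
def natArrowMap {P Q P' Q' : O ⥤ D} {α : P ⟶ Q} {α' : P' ⟶ Q'} (l : P ⟶ P') (r : Q ⟶ Q')
    (h : α ≫ r = l ≫ α') : natArrow α ⟶ natArrow α' where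
  app o := Arrow.homMk (l.app o) (r.app o) (NatTrans.congr_app h.symm o)
  naturality _ _ f := by
    ext
    · exact l.naturality f
    · exact r.naturality f

/-- The left component of a morphism between functors to the category of arrows. -/
@[simps]
def natArrowLeft {P Q P' Q' : O ⥤ D} {α : P ⟶ Q} {α' : P' ⟶ Q'} (t : natArrow α ⟶ natArrow α') :
    P ⟶ P' where
  app o := (t.app o).left
  naturality _ _ h := congrArg (fun f => CommaMorphism.left f) (t.naturality h)

/-- The right component of a morphism between functors to the category of arrows. -/
@[simps]
def natArrowRight {P Q P' Q' : O ⥤ D} {α : P ⟶ Q} {α' : P' ⟶ Q'}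
    (t : natArrow α ⟶ natArrow α') : Q ⟶ Q' where
  app o := (t.app o).right
  naturality _ _ h := congrArg (fun f => CommaMorphism.right f) (t.naturality h)

@[simp]
lemma natArrowLeft_natArrowMap {P Q P' Q' : O ⥤ D} {α : P ⟶ Q} {α' : P' ⟶ Q'} (l : P ⟶ P')
    (r : Q ⟶ Q') (h : α ≫ r = l ≫ α') : natArrowLeft (natArrowMap l r h) = l := rfl

@[simp]
lemma natArrowRight_natArrowMap {P Q P' Q' : O ⥤ D} {α : P ⟶ Q} {α' : P' ⟶ Q'} (l : P ⟶ P')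
    (r : Q ⟶ Q') (h : α ≫ r = l ≫ α') : natArrowRight (natArrowMap l r h) = r := rfl

@[simp]
lemma natArrowLeft_comp {P Q P' Q' P'' Q'' : O ⥤ D} {α : P ⟶ Q} {α' : P' ⟶ Q'} {α'' : P'' ⟶ Q''}
    (t : natArrow α ⟶ natArrow α') (t' : natArrow α' ⟶ natArrow α'') :
    natArrowLeft (t ≫ t') = natArrowLeft t ≫ natArrowLeft t' := rfl

@[simp]
lemma natArrowRight_comp {P Q P' Q' P'' Q'' : O ⥤ D} {α : P ⟶ Q} {α' : P' ⟶ Q'}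
    {α'' : P'' ⟶ Q''} (t : natArrow α ⟶ natArrow α') (t' : natArrow α' ⟶ natArrow α'') :
    natArrowRight (t ≫ t') = natArrowRight t ≫ natArrowRight t' := rfl

lemma natArrow_w {P Q P' Q' : O ⥤ D} {α : P ⟶ Q} {α' : P' ⟶ Q'}
    (t : natArrow α ⟶ natArrow α') : natArrowLeft t ≫ α' = α ≫ natArrowRight t := by
  ext o
  exact (t.app o).w

lemma natArrow_hom_ext {P Q P' Q' : O ⥤ D} {α : P ⟶ Q} {α' : P' ⟶ Q'}
    {t t' : natArrow α ⟶ natArrow α'} (h₁ : natArrowLeft t = natArrowLeft t')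
    (h₂ : natArrowRight t = natArrowRight t') : t = t' := by
  ext o
  · exact NatTrans.congr_app h₁ o
  · exact NatTrans.congr_app h₂ o

/-- The morphism from `𝟙 X` to `x` which represents corner lifting problems with respect to `x`. -/
abbrev natArrowHat {X Y : O ⥤ D} (x : X ⟶ Y) : natArrow (𝟙 X) ⟶ natArrow x :=
  natArrowMap (𝟙 X) x rfl

/-- A map from an arrow to `𝟙 X` is the same as a map from its target to `X`, and a map to `x` is a
commutative square. A lifting problem against `natArrowHat x` is therefore a triple `u`, `v`, `t` as
in `CornerLift`, and a solution is a single map `Q' ⟶ X`. This reduces two-variable statements to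
one variable with values in arrows. -/
lemma hasLiftingProperty_natArrowHat_iff {P Q P' Q' X Y : O ⥤ D} {α : P ⟶ Q} {α' : P' ⟶ Q'}
    (l : P ⟶ P') (r : Q ⟶ Q') (h : α ≫ r = l ≫ α') (x : X ⟶ Y) :
    HasLiftingProperty (natArrowMap l r h) (natArrowHat x) ↔ CornerLift α l r α' x := by
  rw [hasLiftingProperty_iff_exists]
  constructor
  · intro H u v t e1 e2 e3
    obtain ⟨d, hd1, hd2⟩ := H (natArrowMap (α ≫ u) u (by simp)) (natArrowMap v t e3.symm)
      (natArrow_hom_ext (by simpa using e1) (by simpa using e2))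
    have h1 := congrArg natArrowRight hd1
    have h2 := congrArg natArrowRight hd2
    have h3 := congrArg natArrowLeft hd2
    simp only [natArrowLeft_comp, natArrowRight_comp, natArrowLeft_natArrowMap,
      natArrowRight_natArrowMap, Category.comp_id] at h1 h2 h3
    exact ⟨natArrowRight d, h1, by rw [← natArrow_w d, Category.comp_id, h3], h2⟩
  · intro H a b e
    have ha := natArrow_w a
    have hb := natArrow_w b
    have h1 := congrArg natArrowRight e
    have h2 := congrArg natArrowLeft e
    simp only [natArrowLeft_comp, natArrowRight_comp, natArrowLeft_natArrowMap,
      natArrowRight_natArrowMap, Category.comp_id] at h1 h2 ha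
    obtain ⟨d, hd1, hd2, hd3⟩ := H (natArrowRight a) (natArrowLeft b) (natArrowRight b)
      (by rw [← ha, h2]) h1 hb
    refine ⟨natArrowMap (α' ≫ d) d (by simp), natArrow_hom_ext ?_ ?_, natArrow_hom_ext ?_ ?_⟩
    · simp [ha, ← hd1, reassoc_of% h]
    · simp [hd1]
    · simp [hd2]
    · simp [hd3]

variable {A : Type u} [Category.{v} A]

/-- A morphism between functors `A ⥤ O ⥤ D`, as a functor `A ⥤ O ⥤ Arrow D`. -/
@[simps]
def natArrow₂ {Θ Θ' : A ⥤ O ⥤ D} (α : Θ ⟶ Θ') : A ⥤ O ⥤ Arrow D where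
  obj K := natArrow (α.app K)
  map k := natArrowMap (Θ.map k) (Θ'.map k) (α.naturality k).symm

lemma preservesColimitsOfSize_natArrow₂ {Θ Θ' : A ⥤ O ⥤ D} (α : Θ ⟶ Θ') (o : O)
    (h : PreservesColimitsOfSize.{w, w} (Θ ⋙ (evaluation O D).obj o))
    (h' : PreservesColimitsOfSize.{w, w} (Θ' ⋙ (evaluation O D).obj o)) :
    PreservesColimitsOfSize.{w, w} (natArrow₂ α ⋙ (evaluation O (Arrow D)).obj o) := by
  have : PreservesColimitsOfSize.{w, w}
    ((natArrow₂ α ⋙ (evaluation O (Arrow D)).obj o) ⋙ Arrow.leftFunc) := h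
  have : PreservesColimitsOfSize.{w, w}
    ((natArrow₂ α ⋙ (evaluation O (Arrow D)).obj o) ⋙ Arrow.rightFunc) := h'
  exact preservesColimitsOfSize_arrow _

end

end CategoryTheory

/-! ### Diagrams twisted by a symmetric sequence, and their restriction to structured arrows -/

namespace SymSeq

section

variable {C : Type u} [Category.{v} C]

variable {O : Type u''} [Category.{v''} O] {D : Type u'} [Category.{v'} D]

/-- The functor which sends `A` to `o ↦ Θ(A(π(o)))(o)`. -/
def twist (π : O ⥤ FinSet) (Θ : C ⥤ O ⥤ D) : SymSeq C ⥤ O ⥤ D where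
  obj A :=
    { obj := fun o => (Θ.obj (A.obj (π.obj o))).obj o
      map := fun {o o'} h => (Θ.obj _).map h ≫ (Θ.map (A.map (π.map h))).app o'
      map_id := fun o => by simp
      map_comp := fun h h' => by simp }
  map {A A'} a :=
    { app := fun o => (Θ.map (a.app (π.obj o))).app o
      naturality := fun o o' h => by
        change ((Θ.obj (A.obj (π.obj o))).map h ≫ (Θ.map (A.map (π.map h))).app o') ≫
          (Θ.map (a.app (π.obj o'))).app o' = (Θ.map (a.app (π.obj o))).app o ≫
            (Θ.obj (A'.obj (π.obj o))).map h ≫ (Θ.map (A'.map (π.map h))).app o'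
        rw [Category.assoc, ← NatTrans.comp_app, ← Functor.map_comp, a.naturality,
          Functor.map_comp, NatTrans.comp_app, NatTrans.naturality_assoc] }

variable {π : O ⥤ FinSet} {Θ : C ⥤ O ⥤ D}

/-- The components of a morphism from `(twist π Θ).obj A`. -/
def twistApp {A : SymSeq C} {X : O ⥤ D} (u : (twist π Θ).obj A ⟶ X) (o : O) :
    (Θ.obj (A.obj (π.obj o))).obj o ⟶ X.obj o :=
  u.app o

lemma twistApp_naturality {A : SymSeq C} {X : O ⥤ D} (u : (twist π Θ).obj A ⟶ X) {o o' : O}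
    (h : o ⟶ o') : (Θ.obj (A.obj (π.obj o))).map h ≫ (Θ.map (A.map (π.map h))).app o' ≫
      twistApp u o' = twistApp u o ≫ X.map h :=
  (Category.assoc _ _ _).symm.trans (u.naturality h)

lemma preservesColimitsOfSize_twist [HasColimits C] (π : O ⥤ FinSet)
    (Θ : C ⥤ O ⥤ D) (hΘ : ∀ o, PreservesColimitsOfSize.{v, v} (Θ ⋙ (evaluation O D).obj o)) :
    PreservesColimitsOfSize.{v, v} (twist π Θ) :=
  ⟨fun {J} _ => preservesColimitsOfShape_of_evaluation _ J fun o => by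
    have := hΘ o
    exact inferInstanceAs (PreservesColimitsOfShape J
      ((evaluation FinSet C).obj (π.obj o) ⋙ (Θ ⋙ (evaluation O D).obj o)))⟩

variable [HasColimits C]

/-- The inclusion of a summand in the value of a free symmetric sequence. -/
noncomputable def freeInj {r : ℕ} (K : C) {J : FinSet} (σ : ord r ⟶ J) :
    K ⟶ ((free r).obj K).obj J :=
  Sigma.ι (fun _ : ord r ⟶ J => K) σ

/-- The value of a free symmetric sequence is a coproduct. -/
noncomputable def isColimitFreeInj (r : ℕ) (K : C) (J : FinSet) :
    IsColimit (Cofan.mk (((free r).obj K).obj J) fun σ : ord r ⟶ J => freeInj K σ) :=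
  coproductIsCoproduct fun _ : ord r ⟶ J => K

lemma freeInj_map {r : ℕ} (K : C) {J J' : FinSet} (σ : ord r ⟶ J) (θ : J ⟶ J') :
    freeInj K σ ≫ ((free r).obj K).map θ = freeInj K (σ ≫ θ) :=
  Sigma.ι_desc _ _

lemma freeInj_free_map {r : ℕ} {K K' : C} (k : K ⟶ K') {J : FinSet} (σ : ord r ⟶ J) :
    freeInj K σ ≫ ((free r).map k).app J = k ≫ freeInj K' σ :=
  Sigma.ι_desc _ _

/-- The colimit cofan expressing `Θ(F_r(K)(J))(o)` as a coproduct. -/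
noncomputable def isColimitMapFreeInj (o : O)
    (hΘ : PreservesColimitsOfSize.{v, v} (Θ ⋙ (evaluation O D).obj o)) (r : ℕ) (K : C)
    (J : FinSet) :
    IsColimit (Cofan.mk ((Θ.obj (((free r).obj K).obj J)).obj o)
      fun σ : ord r ⟶ J => (Θ.map (freeInj K σ)).app o) :=
  haveI : PreservesColimitsOfSize.{0, 0} (Θ ⋙ (evaluation O D).obj o) :=
    preservesColimitsOfSize_shrink _
  isColimitCofanMkObjOfIsColimit (Θ ⋙ (evaluation O D).obj o) _ _ (isColimitFreeInj r K J)

/-- The restriction to structured arrows of a morphism from `twist π Θ` of a free sequence. -/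
noncomputable def twistRestrict {r : ℕ} {K : C} {X : O ⥤ D}
    (u : (twist π Θ).obj ((free r).obj K) ⟶ X) :
    StructuredArrow.proj (ord r) π ⋙ Θ.obj K ⟶ StructuredArrow.proj (ord r) π ⋙ X where
  app s := (Θ.map (freeInj K s.hom)).app s.right ≫ twistApp u s.right
  naturality s s' h := by
    change (Θ.obj K).map h.right ≫ (Θ.map (freeInj K s'.hom)).app s'.right ≫
      twistApp u s'.right = ((Θ.map (freeInj K s.hom)).app s.right ≫ twistApp u s.right) ≫
        X.map h.right
    have e : freeInj K s'.hom = freeInj K s.hom ≫ ((free r).obj K).map (π.map h.right) := by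
      rw [freeInj_map, StructuredArrow.w h]
    rw [e, Category.assoc, ← twistApp_naturality, Functor.map_comp, NatTrans.comp_app,
      Category.assoc, NatTrans.naturality_assoc]

lemma twist_free_hom_ext
    (hΘ : ∀ o, PreservesColimitsOfSize.{v, v} (Θ ⋙ (evaluation O D).obj o))
    {r : ℕ} {K : C} {X : O ⥤ D} {u u' : (twist π Θ).obj ((free r).obj K) ⟶ X}
    (h : twistRestrict u = twistRestrict u') : u = u' := by
  ext o
  refine Cofan.IsColimit.hom_ext (isColimitMapFreeInj o (hΘ o) r K (π.obj o)) _ _ fun σ => ?_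
  exact NatTrans.congr_app h (StructuredArrow.mk σ)

/-- Every morphism on structured arrows extends to `twist π Θ` of a free sequence. -/
lemma exists_twistRestrict_eq
    (hΘ : ∀ o, PreservesColimitsOfSize.{v, v} (Θ ⋙ (evaluation O D).obj o))
    {r : ℕ} {K : C} {X : O ⥤ D}
    (d : StructuredArrow.proj (ord r) π ⋙ Θ.obj K ⟶ StructuredArrow.proj (ord r) π ⋙ X) :
    ∃ u : (twist π Θ).obj ((free r).obj K) ⟶ X, twistRestrict u = d := by
  let δ (o : O) (σ : ord r ⟶ π.obj o) : (Θ.obj K).obj o ⟶ X.obj o := d.app (StructuredArrow.mk σ)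
  have hδ : ∀ {o o' : O} (h : o ⟶ o') (σ : ord r ⟶ π.obj o),
      -- Naturality of `d` is used for the morphism of structured arrows from `σ` to `σ ≫ π.map h`
      -- lying over `h`.
      (Θ.obj K).map h ≫ δ o' (σ ≫ π.map h) = δ o σ ≫ X.map h := fun h σ =>
    d.naturality (StructuredArrow.homMk h rfl :
      StructuredArrow.mk σ ⟶ StructuredArrow.mk (σ ≫ π.map h))
  let ε (o : O) : (Θ.obj (((free r).obj K).obj (π.obj o))).obj o ⟶ X.obj o :=
    Cofan.IsColimit.desc (isColimitMapFreeInj o (hΘ o) r K (π.obj o)) (δ o)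
  have fac : ∀ (o : O) (σ : ord r ⟶ π.obj o), (Θ.map (freeInj K σ)).app o ≫ ε o = δ o σ :=
    fun o σ => Cofan.IsColimit.fac (isColimitMapFreeInj o (hΘ o) r K (π.obj o)) _ σ
  refine ⟨⟨ε, fun o o' h => ?_⟩, ?_⟩
  · refine Cofan.IsColimit.hom_ext (isColimitMapFreeInj o (hΘ o) r K (π.obj o)) _ _ fun σ => ?_
    change (Θ.map (freeInj K σ)).app o ≫ ((Θ.obj (((free r).obj K).obj (π.obj o))).map h ≫
      (Θ.map (((free r).obj K).map (π.map h))).app o') ≫ ε o' =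
        (Θ.map (freeInj K σ)).app o ≫ ε o ≫ X.map h
    rw [reassoc_of% (fac o σ), ← hδ, ← fac, Category.assoc, ← NatTrans.naturality_assoc,
      ← NatTrans.comp_app_assoc, ← Functor.map_comp, freeInj_map]
  · ext s
    exact fac s.right s.hom

/-- The lifting property for `twist π Θ` of a free morphism follows from a lifting property on
structured arrows. -/
lemma hasLiftingProperty_twist_free
    (hΘ : ∀ o, PreservesColimitsOfSize.{v, v} (Θ ⋙ (evaluation O D).obj o))
    {r : ℕ} {K K' : C} (k : K ⟶ K') {X Y : O ⥤ D} (x : X ⟶ Y)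
    (h : HasLiftingProperty (Functor.whiskerLeft (StructuredArrow.proj (ord r) π) (Θ.map k))
      (Functor.whiskerLeft (StructuredArrow.proj (ord r) π) x)) :
    HasLiftingProperty ((twist π Θ).map ((free r).map k)) x := by
  rw [hasLiftingProperty_iff_exists] at h ⊢
  have hk : ∀ {Z : O ⥤ D} (t : (twist π Θ).obj ((free r).obj K') ⟶ Z),
      twistRestrict ((twist π Θ).map ((free r).map k) ≫ t) =
        Functor.whiskerLeft (StructuredArrow.proj (ord r) π) (Θ.map k) ≫ twistRestrict t := by
    intro Z t
    ext s
    change (Θ.map (freeInj K s.hom)).app s.right ≫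
      (Θ.map (((free r).map k).app (π.obj s.right))).app s.right ≫ twistApp t s.right =
        (Θ.map k).app s.right ≫ (Θ.map (freeInj K' s.hom)).app s.right ≫ twistApp t s.right
    rw [← NatTrans.comp_app_assoc, ← Functor.map_comp, freeInj_free_map, Functor.map_comp,
      NatTrans.comp_app_assoc]
  have hx : ∀ {L : C} (t : (twist π Θ).obj ((free r).obj L) ⟶ X),
      twistRestrict (t ≫ x) = twistRestrict t ≫
        Functor.whiskerLeft (StructuredArrow.proj (ord r) π) x := by
    intro L t
    ext s
    exact (Category.assoc _ _ _).symm
  intro u t e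
  obtain ⟨d, hd1, hd2⟩ := h (twistRestrict u) (twistRestrict t) (by rw [← hx, e, hk])
  obtain ⟨d, rfl⟩ := exists_twistRestrict_eq hΘ d
  exact ⟨d, twist_free_hom_ext hΘ (by rw [hk, hd1]), twist_free_hom_ext hΘ (by rw [hx, hd2])⟩

end

variable {C : Type u} [Category.{v} C] [ModelCategory C] [HasColimits C] [CofibrantlyGenerated C]
variable {O : Type u''} [Category.{v''} O] {D : Type u'} [Category.{v'} D]

/-- The lifting property of `twist π Θ` of a projective (trivial) cofibration. -/
lemma hasLiftingProperty_twist (π : O ⥤ FinSet) (Θ : C ⥤ O ⥤ D)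
    (hΘ : ∀ o, PreservesColimitsOfSize.{v, v} (Θ ⋙ (evaluation O D).obj o)) (a : Bool)
    {X Y : O ⥤ D} (x : X ⟶ Y)
    (h : ∀ (r : ℕ) {K K' : C} (k : K ⟶ K'), cofClass C a k →
      HasLiftingProperty (Functor.whiskerLeft (StructuredArrow.proj (ord r) π) (Θ.map k))
      (Functor.whiskerLeft (StructuredArrow.proj (ord r) π) x))
    {A A' : SymSeq C} (i : A ⟶ A') (hi : projCof C a i) :
    HasLiftingProperty ((twist π Θ).map i) x := by
  have := preservesColimitsOfSize_twist π Θ hΘ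
  -- The class `W` consists of `x` alone, so that the reduction to free morphisms applies to one
  -- fixed lifting problem.
  refine map_mem_llp_of_free a (MorphismProperty.ofHoms fun _ : Unit => x) (twist π Θ) ?_ i hi
    x ⟨()⟩
  rintro r K K' k hk _ _ _ ⟨⟩
  exact hasLiftingProperty_twist_free hΘ k x (h r k hk)

end SymSeq

namespace CategoryTheory

lemma CornerLift.symm {E : Type u'} [Category.{v'} E] {P Q₁ Q₂ Q X Y : E} {f₁ : P ⟶ Q₁}
    {f₂ : P ⟶ Q₂} {g₁ : Q₁ ⟶ Q} {g₂ : Q₂ ⟶ Q} {x : X ⟶ Y} (h : CornerLift f₁ f₂ g₁ g₂ x) :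
    CornerLift f₂ f₁ g₂ g₁ x := by
  intro u v t e1 e2 e3
  obtain ⟨d, h1, h2, h3⟩ := h v u t e1.symm e3 e2
  exact ⟨d, h2, h1, h3⟩

end CategoryTheory

/-! ### The pushout-product axiom with one twisted factor -/

namespace SymSeq

lemma preservesColimitsOfSize_comp_whiskeringLeft {C : Type u} [Category.{v} C]
    {O : Type u''} [Category.{v''} O] {D : Type u'} [Category.{v'} D] {Θ : C ⥤ O ⥤ D}
    (hΘ : ∀ o, PreservesColimitsOfSize.{v, v} (Θ ⋙ (evaluation O D).obj o))
    {O' : Type*} [Category* O'] (F : O' ⥤ O) :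
    PreservesColimitsOfSize.{v, v} (Θ ⋙ (Functor.whiskeringLeft O' O D).obj F) :=
  ⟨fun {J} _ => preservesColimitsOfShape_of_evaluation _ J fun o => by
    have := hΘ (F.obj o)
    exact inferInstanceAs (PreservesColimitsOfShape J (Θ ⋙ (evaluation O D).obj (F.obj o)))⟩

section

variable {C : Type u} [Category.{v} C] [MonoidalCategory C]
variable {O : Type u''} [Category.{v''} O] {D : Type u'} [Category.{v'} D]

/-- The functor which sends `B` and `K` to `o ↦ Θ(K ⊗ B(π(o)))(o)`. -/
def tensorTwist (π : O ⥤ FinSet) (Θ : C ⥤ O ⥤ D) : SymSeq C ⥤ C ⥤ O ⥤ D where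
  obj B :=
    { obj := fun K => (twist π (tensorLeft K ⋙ Θ)).obj B
      map := fun {K K'} k =>
        { app := fun o => (Θ.map (k ▷ B.obj (π.obj o))).app o
          naturality := fun o o' h => by
            change ((Θ.obj (K ⊗ B.obj (π.obj o))).map h ≫ (Θ.map (K ◁ B.map (π.map h))).app o') ≫
              (Θ.map (k ▷ B.obj (π.obj o'))).app o' = (Θ.map (k ▷ B.obj (π.obj o))).app o ≫
                (Θ.obj (K' ⊗ B.obj (π.obj o))).map h ≫ (Θ.map (K' ◁ B.map (π.map h))).app o'
            rw [Category.assoc, ← NatTrans.comp_app, ← Functor.map_comp, whisker_exchange,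
              Functor.map_comp, NatTrans.comp_app, NatTrans.naturality_assoc] }
      map_id := fun K => by
        ext o
        change (Θ.map (𝟙 K ▷ B.obj (π.obj o))).app o = 𝟙 ((Θ.obj (K ⊗ B.obj (π.obj o))).obj o)
        simp
      map_comp := fun k k' => by
        ext o
        change (Θ.map ((k ≫ k') ▷ B.obj (π.obj o))).app o =
          (Θ.map (k ▷ B.obj (π.obj o))).app o ≫ (Θ.map (k' ▷ B.obj (π.obj o))).app o
        simp }
  map b :=
    { app := fun K => (twist π (tensorLeft K ⋙ Θ)).map b
      naturality := fun K K' k => by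
        ext o
        change (Θ.map (k ▷ _)).app o ≫ (Θ.map (K' ◁ _)).app o =
          (Θ.map (K ◁ _)).app o ≫ (Θ.map (k ▷ _)).app o
        rw [← NatTrans.comp_app, ← Functor.map_comp, ← NatTrans.comp_app, ← Functor.map_comp,
          whisker_exchange] }
  map_id B := by
    ext K o
    change (Θ.map (K ◁ (𝟙 B : B ⟶ B).app _)).app o = 𝟙 ((Θ.obj (K ⊗ B.obj (π.obj o))).obj o)
    simp
  map_comp b b' := by
    ext K o
    change (Θ.map _).app o = (Θ.map _).app o ≫ (Θ.map _).app o
    rw [← NatTrans.comp_app, ← Functor.map_comp]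
    simp

/-- Left multiplication by a morphism `k`, composed with `Θ`. -/
abbrev tensorLeftMap (Θ : C ⥤ O ⥤ D) {K K' : C} (k : K ⟶ K') :
    tensorLeft K ⋙ Θ ⟶ tensorLeft K' ⋙ Θ :=
  Functor.whiskerRight ((curriedTensor C).map k) Θ

end

variable {C : Type u} [Category.{v} C] [MonoidalCategory C] [SymmetricCategory C]
  [ModelCategory C] [SymmetricMonoidalModel C]

instance (X : C) : PreservesColimits (tensorLeft X) :=
  SymmetricMonoidalModel.preservesColimits_tensorLeft X

instance (X : C) : PreservesColimits (tensorRight X) :=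
  SymmetricMonoidalModel.preservesColimits_tensorRight X

/-- Both clauses of the pushout-product axiom in one statement: the Boolean `a || b` is `true`
exactly when one of the two maps is assumed trivial. -/
lemma pushout_product_mem {a b : Bool} {K K' L L' : C} (f : K ⟶ K') (g : L ⟶ L')
    (hf : cofClass C a f) (hg : cofClass C b g) :
    cofClass C (a || b) (pushout.desc (K' ◁ g) (f ▷ L') (whisker_exchange f g).symm :
      pushout (f ▷ L) (K ◁ g) ⟶ K' ⊗ L') := by
  have hf' : Cofibration f := by
    cases a
    · rwa [cofClass_false, ← cofibration_iff] at hf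
    · rw [cofClass_true] at hf
      exact (cofibration_iff _).2 hf.1
  have hg' : Cofibration g := by
    cases b
    · rwa [cofClass_false, ← cofibration_iff] at hg
    · rw [cofClass_true] at hg
      exact (cofibration_iff _).2 hg.1
  have h := SymmetricMonoidalModel.pushout_product f g hf' hg'
  have h' := SymmetricMonoidalModel.pushout_product_trivial f g hf' hg'
  rw [cofibration_iff] at h
  simp only [weakEquivalence_iff] at h'
  cases a
  · cases b
    · rwa [Bool.or_false, cofClass_false]
    · rw [cofClass_true] at hg
      rw [Bool.false_or, cofClass_true]
      exact ⟨h, h' (Or.inr hg.2)⟩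
  · rw [cofClass_true] at hf
    rw [Bool.true_or, cofClass_true]
    exact ⟨h, h' (Or.inl hf.2)⟩

variable {O : Type u''} [Category.{v''} O] {D : Type u'} [Category.{v'} D]

lemma preservesColimitsOfSize_tensorTwist (π : O ⥤ FinSet) {Θ : C ⥤ O ⥤ D}
    (hΘ : ∀ o, PreservesColimitsOfSize.{v, v} (Θ ⋙ (evaluation O D).obj o)) (B : SymSeq C) (o : O) :
    PreservesColimitsOfSize.{v, v} ((tensorTwist π Θ).obj B ⋙ (evaluation O D).obj o) := by
  have := hΘ o
  exact inferInstanceAs (PreservesColimitsOfSize.{v, v}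
    (tensorRight (B.obj (π.obj o)) ⋙ (Θ ⋙ (evaluation O D).obj o)))

lemma preservesColimitsOfSize_tensorLeft_comp {Θ : C ⥤ O ⥤ D}
    (hΘ : ∀ o, PreservesColimitsOfSize.{v, v} (Θ ⋙ (evaluation O D).obj o)) (K : C) (o : O) :
    PreservesColimitsOfSize.{v, v} ((tensorLeft K ⋙ Θ) ⋙ (evaluation O D).obj o) := by
  have := hΘ o
  exact inferInstanceAs (PreservesColimitsOfSize.{v, v}
    (tensorLeft K ⋙ (Θ ⋙ (evaluation O D).obj o)))

/-- A functor `Θ` which sends corner maps of tensor products to morphisms with a lifting property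
satisfies a corner lifting property for tensor products. -/
lemma cornerLift_tensor {a b : Bool} (Θ : C ⥤ O ⥤ D) [PreservesColimitsOfSize.{v, v} Θ]
    {X Y : O ⥤ D} (x : X ⟶ Y)
    (h : ∀ {L L' : C} (l : L ⟶ L'), cofClass C (a || b) l → HasLiftingProperty (Θ.map l) x)
    {K K' L L' : C} (k : K ⟶ K') (l : L ⟶ L') (hk : cofClass C a k) (hl : cofClass C b l) :
    CornerLift (Θ.map (k ▷ L)) (Θ.map (K ◁ l)) (Θ.map (K' ◁ l)) (Θ.map (k ▷ L')) x := by
  have : PreservesColimitsOfSize.{0, 0} Θ := preservesColimitsOfSize_shrink _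
  refine CornerLift.of_pushout ((IsPushout.of_hasPushout (k ▷ L) (K ◁ l)).map Θ)
    (c := Θ.map (pushout.desc (K' ◁ l) (k ▷ L') (whisker_exchange k l).symm)) ?_ ?_
    (h _ (pushout_product_mem k l hk hl))
  · rw [← Functor.map_comp, pushout.inl_desc]
  · rw [← Functor.map_comp, pushout.inr_desc]

variable [HasColimits C]

lemma isInitialTensorTwistObj (π : O ⥤ FinSet) (Θ : C ⥤ O ⥤ D)
    (hΘ : ∀ o, PreservesColimitsOfSize.{v, v} (Θ ⋙ (evaluation O D).obj o)) {B : SymSeq C}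
    (hB : IsInitial B) (K : C) : Nonempty (IsInitial (((tensorTwist π Θ).obj B).obj K)) := by
  have := preservesColimitsOfSize_twist π _ (preservesColimitsOfSize_tensorLeft_comp hΘ K)
  have : PreservesColimitsOfSize.{0, 0} (twist π (tensorLeft K ⋙ Θ)) :=
    preservesColimitsOfSize_shrink _
  exact ⟨hB.isInitialObj (twist π (tensorLeft K ⋙ Θ))⟩

variable [CofibrantlyGenerated C]

/-- The corner lifting property of the functor `tensorTwist π Θ` follows from lifting properties
on structured arrows. -/
lemma cornerLift_tensorTwist (π : O ⥤ FinSet) (Θ : C ⥤ O ⥤ D)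
    (hΘ : ∀ o, PreservesColimitsOfSize.{v, v} (Θ ⋙ (evaluation O D).obj o)) (a b : Bool)
    {X Y : O ⥤ D} (x : X ⟶ Y)
    (h : ∀ (r : ℕ) {L L' : C} (l : L ⟶ L'), cofClass C (a || b) l →
      HasLiftingProperty (Functor.whiskerLeft (StructuredArrow.proj (ord r) π) (Θ.map l))
      (Functor.whiskerLeft (StructuredArrow.proj (ord r) π) x))
    {K K' : C} (k : K ⟶ K') (hk : cofClass C a k)
    {B B' : SymSeq C} (j : B ⟶ B') (hj : projCof C b j) :
    CornerLift (((tensorTwist π Θ).map j).app K) (((tensorTwist π Θ).obj B).map k)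
      (((tensorTwist π Θ).obj B').map k) (((tensorTwist π Θ).map j).app K') x := by
  refine CornerLift.symm ((hasLiftingProperty_natArrowHat_iff (((tensorTwist π Θ).map j).app K)
    (((tensorTwist π Θ).map j).app K') (((tensorTwist π Θ).map j).naturality k) x).1 ?_)
  -- With `k` fixed, the transformation `Θ(K ⊗ -) ⟶ Θ(K' ⊗ -)` is one arrow-valued functor, and its
  -- twist along `j` is the square in question. Only the case of a free `j` on a map `l` remains,
  -- where the square is the image of the pushout-product square of `k` and `l`.
  have key := hasLiftingProperty_twist π (natArrow₂ (tensorLeftMap Θ k))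
    (fun o => preservesColimitsOfSize_natArrow₂ _ o
      (preservesColimitsOfSize_tensorLeft_comp hΘ K o)
      (preservesColimitsOfSize_tensorLeft_comp hΘ K' o)) b (natArrowHat x) ?_ j hj
  · exact key
  · intro r L L' l hl
    have := preservesColimitsOfSize_comp_whiskeringLeft hΘ (StructuredArrow.proj (ord r) π)
    have c := cornerLift_tensor (a := a) (b := b)
      (Θ ⋙ (Functor.whiskeringLeft _ _ _).obj (StructuredArrow.proj (ord r) π))
      (Functor.whiskerLeft (StructuredArrow.proj (ord r) π) x) (h r) k l hk hl
    exact (hasLiftingProperty_natArrowHat_iff _ _ (by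
      rw [← Functor.map_comp, ← Functor.map_comp, whisker_exchange]) _).2 c

/-- The case of the corner lifting property where `j` is the map from the initial sequence to `B`:
the source column then consists of initial objects and the corner map is the remaining column.
Cofibrancy of `B` enters here, through the Boolean `false`. -/
lemma hasLiftingProperty_tensorTwist (π : O ⥤ FinSet) (Θ : C ⥤ O ⥤ D)
    (hΘ : ∀ o, PreservesColimitsOfSize.{v, v} (Θ ⋙ (evaluation O D).obj o)) (a : Bool)
    {X Y : O ⥤ D} (x : X ⟶ Y)
    (h : ∀ (r : ℕ) {L L' : C} (l : L ⟶ L'), cofClass C a l →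
      HasLiftingProperty (Functor.whiskerLeft (StructuredArrow.proj (ord r) π) (Θ.map l))
      (Functor.whiskerLeft (StructuredArrow.proj (ord r) π) x))
    {K K' : C} (k : K ⟶ K') (hk : cofClass C a k) (B : SymSeq C) [hB : IsCofibrant B] :
    HasLiftingProperty (((tensorTwist π Θ).obj B).map k) x := by
  have c := cornerLift_tensorTwist π Θ hΘ a false x (by simpa using h) k hk (initial.to B)
    ((cofibration_iff_projCof _).1 ((isCofibrant_iff B).1 hB))
  obtain ⟨h1⟩ := isInitialTensorTwistObj π Θ hΘ initialIsInitial K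
  obtain ⟨h2⟩ := isInitialTensorTwistObj π Θ hΘ initialIsInitial K'
  exact c.hasLiftingProperty_of_isInitial h1 h2

end SymSeq

/-! ### Iterated tensor products of twisted factors -/

namespace SymSeq

section

variable {C : Type u} [Category.{v} C] [MonoidalCategory C]
variable {O : Type u''} [Category.{v''} O] {D : Type u'} [Category.{v'} D]

/-- The functoriality of `tensorTwist` in the functor `Θ`. -/
def tensorTwistMap (π : O ⥤ FinSet) {Θ Θ' : C ⥤ O ⥤ D} (α : Θ ⟶ Θ') (B : SymSeq C) :
    (tensorTwist π Θ).obj B ⟶ (tensorTwist π Θ').obj B where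
  app K :=
    { app := fun o => (α.app (K ⊗ B.obj (π.obj o))).app o
      naturality := fun o o' h => by
        change ((Θ.obj (K ⊗ B.obj (π.obj o))).map h ≫ (Θ.map (K ◁ B.map (π.map h))).app o') ≫
          (α.app (K ⊗ B.obj (π.obj o'))).app o' = (α.app (K ⊗ B.obj (π.obj o))).app o ≫
            (Θ'.obj (K ⊗ B.obj (π.obj o))).map h ≫ (Θ'.map (K ◁ B.map (π.map h))).app o'
        rw [Category.assoc, ← NatTrans.comp_app, α.naturality, NatTrans.comp_app,
          NatTrans.naturality_assoc] }
  naturality K K' k := by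
    ext o
    change (Θ.map (k ▷ B.obj (π.obj o))).app o ≫ (α.app (K' ⊗ B.obj (π.obj o))).app o =
      (α.app (K ⊗ B.obj (π.obj o))).app o ≫ (Θ'.map (k ▷ B.obj (π.obj o))).app o
    rw [← NatTrans.comp_app, α.naturality, NatTrans.comp_app]

lemma tensorTwistMap_naturality (π : O ⥤ FinSet) {Θ Θ' : C ⥤ O ⥤ D} (α : Θ ⟶ Θ')
    {B B' : SymSeq C} (j : B ⟶ B') : tensorTwistMap π α B ≫ (tensorTwist π Θ').map j =
      (tensorTwist π Θ).map j ≫ tensorTwistMap π α B' := by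
  ext K o
  change (α.app _).app o ≫ (Θ'.map (K ◁ j.app (π.obj o))).app o =
    (Θ.map (K ◁ j.app (π.obj o))).app o ≫ (α.app _).app o
  rw [← NatTrans.comp_app, ← α.naturality, NatTrans.comp_app]

/-- The functor which sends `B` and `K` to `o ↦ Γ(B)(K ⊗ B(π(o)))(o)`. -/
def consTwist (π : O ⥤ FinSet) (Γ : SymSeq C ⥤ C ⥤ O ⥤ D) : SymSeq C ⥤ C ⥤ O ⥤ D where
  obj B := (tensorTwist π (Γ.obj B)).obj B
  map {B B'} j := tensorTwistMap π (Γ.map j) B ≫ (tensorTwist π (Γ.obj B')).map j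
  map_id B := by
    ext K o
    change ((Γ.map (𝟙 B)).app _).app o ≫ ((Γ.obj B).map (K ◁ (𝟙 B : B ⟶ B).app _)).app o =
      𝟙 ((((Γ.obj B).obj (K ⊗ B.obj (π.obj o)))).obj o)
    simp
  map_comp {B B' B''} j j' := by
    have e : tensorTwistMap π (Γ.map (j ≫ j')) B =
        tensorTwistMap π (Γ.map j) B ≫ tensorTwistMap π (Γ.map j') B := by
      rw [Γ.map_comp]
      rfl
    rw [e, Functor.map_comp, Category.assoc, Category.assoc,
      ← reassoc_of% (tensorTwistMap_naturality π (Γ.map j') j)]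

/-- The functor which sends `B` and `K` to the diagram `o ↦ (K ⊗ B(π₁(o))) ⊗ ⋯ ⊗ B(πₖ(o))`. -/
def listTwist {I : Type w} (π : I → O ⥤ FinSet) : List I → (SymSeq C ⥤ C ⥤ O ⥤ C)
  | [] => (Functor.const (SymSeq C)).obj (Functor.const O)
  | a :: l => consTwist (π a) (listTwist π l)

/-- Treating one factor replaces the indexing category by structured arrows. Restricted there, the
remaining factors again form a diagram of the same kind, so inductions over the list can continue.
-/
lemma listTwist_comp {I : Type w} (π : I → O ⥤ FinSet) (l : List I) {O' : Type*}
    [Category* O'] (F : O' ⥤ O) : listTwist (C := C) (fun i => F ⋙ π i) l =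
      listTwist π l ⋙ (Functor.whiskeringRight _ _ _).obj
        ((Functor.whiskeringLeft O' O C).obj F) := by
  induction l with
  | nil => rfl
  | cons a l ih =>
    change consTwist (F ⋙ π a) (listTwist (fun i => F ⋙ π i) l) = _
    rw [ih]
    rfl

/-- A family of functors such that the iterated categories of structured arrows over the functors
in the list have initial objects. -/
def Rigid {I : Type w} : List I → ∀ {O : Type 1} [Category.{0} O], (I → O ⥤ FinSet) → Prop
  | [], O, _, _ => ∃ o : O, Nonempty (IsInitial o)
  | a :: l, _, _, π => ∀ r, Rigid l fun i => StructuredArrow.proj (ord r) (π a) ⋙ π i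

end

variable {C : Type u} [Category.{v} C] [MonoidalCategory C] [SymmetricCategory C]
  [ModelCategory C] [SymmetricMonoidalModel C]

lemma preservesColimitsOfSize_listTwist {I : Type w} {O : Type u''} [Category.{v''} O]
    (π : I → O ⥤ FinSet) (l : List I) (B : SymSeq C) (o : O) :
    PreservesColimitsOfSize.{v, v} ((listTwist π l).obj B ⋙ (evaluation O C).obj o) := by
  induction l generalizing o with
  | nil => exact inferInstanceAs (PreservesColimitsOfSize.{v, v} (𝟭 C))
  | cons a l ih => exact preservesColimitsOfSize_tensorTwist (π a) ih B o

variable [HasColimits C] [CofibrantlyGenerated C]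

/-- Each cofibrant factor is removed at the price of passing to structured arrows. When none is
left, rigidity provides an initial object, and maps out of a constant diagram on `K` are maps from
`K` into the value at that object. -/
lemma hasLiftingProperty_listTwist {I : Type w} (l : List I) {O : Type 1} [Category.{0} O]
    (π : I → O ⥤ FinSet) (hπ : Rigid l π) (B : SymSeq C) [IsCofibrant B] {a : Bool}
    {K K' : C} (k : K ⟶ K') (hk : cofClass C a k) {X Y : O ⥤ C} (x : X ⟶ Y)
    (hx : objFib C a O x) : HasLiftingProperty (((listTwist π l).obj B).map k) x := by
  induction l generalizing O K K' with
  | nil =>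
    obtain ⟨o, ⟨ho⟩⟩ := hπ
    rw [hasLiftingProperty_iff_exists]
    intro u t e
    obtain ⟨d, h1, h2⟩ := (hasLiftingProperty_iff_exists _ _).1 (hk _ (hx o)) (u.app o) (t.app o)
      (NatTrans.congr_app e o)
    -- A lift at the initial object extends uniquely along the morphisms out of it.
    let d' : (Functor.const O).obj K' ⟶ X :=
      { app := fun o' => d ≫ X.map (ho.to o')
        naturality := fun o' o'' f => by
          simp [← Functor.map_comp] }
    refine ⟨d', ?_, ?_⟩
    · ext o'
      change k ≫ d ≫ X.map (ho.to o') = u.app o'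
      have h3 := u.naturality (ho.to o')
      rw [← Category.assoc]
      exact (congrArg (· ≫ X.map (ho.to o')) h1).trans (h3.symm.trans (Category.id_comp _))
    · ext o'
      change (d ≫ X.map (ho.to o')) ≫ x.app o' = t.app o'
      have h3 := t.naturality (ho.to o')
      rw [Category.assoc, x.naturality, ← Category.assoc, h2]
      exact h3.symm.trans (Category.id_comp _)
  | cons i l ih =>
    refine hasLiftingProperty_tensorTwist (π i) ((listTwist π l).obj B)
      (preservesColimitsOfSize_listTwist π l B) a x (fun r L L' m hm => ?_) k hk B
    have h := ih _ (hπ r) m hm (Functor.whiskerLeft (StructuredArrow.proj (ord r) (π i)) x)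
      (fun s => hx s.right)
    rw [listTwist_comp] at h
    exact h

/-- The Leibniz rule for the power of `j`: the first factor and the remaining ones are changed
separately, and corner lifting is stable under pasting the two squares. -/
lemma cornerLift_listTwist {I : Type w} (l : List I) {O : Type 1} [Category.{0} O]
    (π : I → O ⥤ FinSet) (hπ : Rigid l π) {a b : Bool} {B B' : SymSeq C} [IsCofibrant B]
    [IsCofibrant B'] (j : B ⟶ B') (hj : projCof C b j)
    {K K' : C} (k : K ⟶ K') (hk : cofClass C a k) {X Y : O ⥤ C} (x : X ⟶ Y)
    (hx : objFib C (a || b) O x) :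
    CornerLift (((listTwist π l).map j).app K) (((listTwist π l).obj B).map k)
      (((listTwist π l).obj B').map k) (((listTwist π l).map j).app K') x := by
  induction l generalizing O K K' with
  | nil =>
    -- With no factor left the diagrams do not depend on `B`; the horizontal maps are identities and
    -- `v` itself is the lift.
    intro u v t e1 e2 e3
    exact ⟨v, e1.symm.trans (Category.id_comp u), Category.id_comp v,
      e3.trans (Category.id_comp t)⟩
  | cons i l ih =>
    -- The first square changes the remaining factors from `B` to `B'` while this factor stays `B`,
    -- which is cofibrant; the induction hypothesis applies to it. The second square changes this
    -- factor while the remaining ones are `B'`; the pushout-product of `k` and `j` absorbs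
    -- triviality, and `hasLiftingProperty_listTwist` applies to `B'`.
    refine CornerLift.paste
      ((tensorTwist (π i) ((listTwist π l).obj B')).map j |>.naturality k) ?_
      (cornerLift_tensorTwist (π i) ((listTwist π l).obj B')
        (preservesColimitsOfSize_listTwist π l B') a b x (fun r L L' m hm => ?_) k hk j hj)
    · refine (hasLiftingProperty_natArrowHat_iff _ _
        ((tensorTwistMap (π i) ((listTwist π l).map j) B).naturality k).symm x).1 ?_
      refine hasLiftingProperty_tensorTwist (π i) (natArrow₂ ((listTwist π l).map j))
        (fun o => preservesColimitsOfSize_natArrow₂ _ o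
          (preservesColimitsOfSize_listTwist π l B o)
          (preservesColimitsOfSize_listTwist π l B' o)) a (natArrowHat x)
        (fun r L L' m hm => ?_) k hk B
      have h := ih _ (hπ r) m hm (Functor.whiskerLeft (StructuredArrow.proj (ord r) (π i)) x)
        (fun s => hx s.right)
      rw [listTwist_comp] at h
      exact (hasLiftingProperty_natArrowHat_iff _ _ (congrArg
        (Functor.whiskerLeft (StructuredArrow.proj (ord r) (π i)))
        (((listTwist π l).map j).naturality m).symm) _).2 h
    · have h := hasLiftingProperty_listTwist l _ (hπ r) B' m hm
        (Functor.whiskerLeft (StructuredArrow.proj (ord r) (π i)) x) (fun s => hx s.right)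
      rw [listTwist_comp] at h
      exact h

end SymSeq

/-! ### The groupoid of maps of finite sets, and rigidity of its fibres -/

namespace SymSeq

/-- Iterated structured arrows choose one labelling at a time; this assembles the labelling at `a`
with those on `l`. The hypothesis `a ∉ l` lets the degree at `a` be prescribed independently. -/
lemma exists_family_cons {I : Type w} {a : I} {l : List I} (ha : a ∉ l) {n n' : I → ℕ}
    (hn : ∀ i ∈ l, n i = n' i) {Y : I → FinSet} (τ : ord (n' a) ⟶ Y a)
    (σ : ∀ i ∈ l, ord (n i) ⟶ Y i) :
    ∃ σ' : ∀ i ∈ a :: l, ord (n' i) ⟶ Y i, σ' a List.mem_cons_self = τ ∧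
      ∀ i hi, σ' i (List.mem_cons_of_mem a hi) = eqToHom (by rw [hn i hi]) ≫ σ i hi := by
  classical
  refine ⟨fun i hi => if e : i = a then eqToHom (by rw [e]) ≫ τ ≫ eqToHom (by rw [e])
    else eqToHom (by rw [hn i (by simpa [e] using hi)]) ≫ σ i (by simpa [e] using hi),
    by simp, fun i hi => ?_⟩
  exact dif_neg fun e : i = a => ha (e ▸ hi)

/-- A family of functors to `FinSet` is rigid if every family of finite sets is classified by an
object. -/
lemma rigid_of_existsUnique {I : Type w} (l : List I) (hl : l.Nodup) {O : Type 1} [Category.{0} O]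
    (π : I → O ⥤ FinSet)
    (h : ∀ n : I → ℕ, ∃ (o : O) (σ : ∀ i ∈ l, ord (n i) ⟶ (π i).obj o),
      ∀ (o' : O) (σ' : ∀ i ∈ l, ord (n i) ⟶ (π i).obj o'),
        ∃! t : o ⟶ o', ∀ i hi, σ i hi ≫ (π i).map t = σ' i hi) : Rigid l π := by
  classical
  induction l generalizing O with
  | nil =>
    obtain ⟨o, σ, ho⟩ := h fun _ => 0
    refine ⟨o, ⟨IsInitial.ofUniqueHom (fun o' => (ho o' fun i hi => absurd hi List.not_mem_nil).choose) fun o' m => ?_⟩⟩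
    exact (ho o' fun i hi => absurd hi List.not_mem_nil).choose_spec.2 m fun i hi => absurd hi List.not_mem_nil
  | cons a l ih =>
    intro r
    rw [List.nodup_cons] at hl
    refine ih hl.2 _ fun n => ?_
    -- The degree `r` of the factor just labelled is stored as the value of `n'` at `a`; this does
    -- not affect `l`, which does not contain `a`.
    obtain ⟨n', rfl, hn⟩ : ∃ n' : I → ℕ, n' a = r ∧ ∀ i ∈ l, n i = n' i :=
      ⟨Function.update n a r, by simp, fun i hi => by
        rw [Function.update_of_ne]
        rintro rfl
        exact hl.1 hi⟩
    obtain ⟨o, σ, ho⟩ := h n'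
    refine ⟨StructuredArrow.mk (σ a (by simp)), fun i hi =>
      eqToHom (by rw [hn i hi]) ≫ σ i (List.mem_cons_of_mem a hi), fun s σ₁ => ?_⟩
    let σ' : ∀ i ∈ l, ord (n i) ⟶ (π i).obj s.right := σ₁
    obtain ⟨σ'', h1, h2⟩ := exists_family_cons (Y := fun i => (π i).obj s.right) hl.1 hn s.hom σ'
    obtain ⟨t, ht, ht'⟩ := ho s.right σ''
    refine ⟨StructuredArrow.homMk t ((ht a (by simp)).trans h1), fun i hi => ?_, fun t' hh => ?_⟩
    · have := ht i (List.mem_cons_of_mem a hi)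
      rw [h2 i hi] at this
      change (eqToHom _ ≫ σ i _) ≫ (π i).map t = σ' i hi
      rw [Category.assoc, this, eqToHom_trans_assoc, eqToHom_refl, Category.id_comp]
    · ext
      refine ht' t'.right fun i hi => ?_
      obtain hi' | hi' := List.mem_cons.1 hi
      · subst hi'
        exact (StructuredArrow.w t').trans h1.symm
      · rw [h2 i hi', ← show _ = σ' i hi' from hh i hi']
        change _ = eqToHom _ ≫ (eqToHom _ ≫ σ i _) ≫ (π i).map t'.right
        simp

/-- A map from a finite set to some `{1, …, r}`. -/
structure FinMap where
  /-- The source of the map. -/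
  source : FinSet
  /-- The map. -/
  under : UnderFin source

/-- Morphisms of maps: a bijection of the sources, and a compatible bijection of the targets. -/
@[ext]
structure FinMap.Hom (o o' : FinMap) where
  /-- The bijection between the sources. -/
  source : o.source ⟶ o'.source
  /-- The bijection between the targets. -/
  target : Fin o.under.r ≃ Fin o'.under.r
  comm : ∀ x, o'.under.map (FinSet.toEquiv source x) = target (o.under.map x)

instance : Category FinMap where
  Hom := FinMap.Hom
  id o := ⟨𝟙 o.source, Equiv.refl _, fun _ => rfl⟩
  comp p q := ⟨p.source ≫ q.source, p.target.trans q.target,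
    fun x => (q.comm _).trans (congrArg q.target (p.comm x))⟩

/-- The source of a map. -/
def FinMap.sourceFunctor : FinMap ⥤ FinSet where
  obj o := o.source
  map h := FinMap.Hom.source h

/-- The target of a map. -/
def FinMap.targetFunctor : FinMap ⥤ FinSet where
  obj o := ord o.under.r
  map h := ordMap (FinMap.Hom.target h)

/-- The bijection between fibres induced by a compatible bijection. -/
def fiberEquiv {J J' : FinSet} {r r' : ℕ} {f : J.carrier → Fin r} {f' : J'.carrier → Fin r'}
    (θ : J ⟶ J') {i : Fin r} {i' : Fin r'} (h : ∀ x, f x = i ↔ f' (FinSet.toEquiv θ x) = i') :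
    fiber f i ⟶ fiber f' i' :=
  FinSet.ofEquiv (Equiv.subtypeEquiv (FinSet.toEquiv θ) h)

/-- The elements of the target of the structured arrow. -/
def FinMap.index {r : ℕ} (s : StructuredArrow (ord r) FinMap.targetFunctor) :
    Fin r ≃ Fin s.right.under.r :=
  FinSet.toEquiv s.hom

lemma FinMap.index_comm {r : ℕ} {s s' : StructuredArrow (ord r) FinMap.targetFunctor}
    (h : s ⟶ s') : FinMap.index s' = (FinMap.index s).trans (FinMap.Hom.target h.right) :=
  (StructuredArrow.w h).symm

lemma FinMap.fiber_iff {r : ℕ} {s s' : StructuredArrow (ord r) FinMap.targetFunctor}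
    (h : s ⟶ s') (i : Fin r) (x : s.right.source.carrier) :
    s.right.under.map x = FinMap.index s i ↔
      s'.right.under.map (FinSet.toEquiv (FinMap.Hom.source h.right) x) = FinMap.index s' i := by
  rw [FinMap.Hom.comm, FinMap.index_comm h]
  exact (Equiv.apply_eq_iff_eq _).symm

/-- The `i`-th fibre of a map whose target is identified with `{1, …, r}`. -/
def FinMap.fiberFunctor (r : ℕ) (i : Fin r) :
    StructuredArrow (ord r) FinMap.targetFunctor ⥤ FinSet where
  obj s := fiber s.right.under.map (FinMap.index s i)
  map h := fiberEquiv (FinMap.Hom.source h.right) (FinMap.fiber_iff h i)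
  map_id _ := rfl
  map_comp _ _ := rfl

/-- A map with target labelled by `{1, …, r}` is the same as an `r`-tuple of finite sets, its
fibres, and bijections may be chosen fibre by fibre. Once every fibre is labelled as well, exactly
one compatible bijection remains. -/
lemma rigid_fiberFunctor (r : ℕ) : Rigid (List.finRange r) (FinMap.fiberFunctor r) := by
  refine rigid_of_existsUnique _ (List.nodup_finRange r) _ fun n => ?_
  -- The universal map with fibres of sizes `n i` is the projection of the disjoint union to its
  -- index set.
  let o : FinMap := ⟨⟨Σ i : Fin r, Fin (n i)⟩, ⟨r, Sigma.fst⟩⟩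
  let s : StructuredArrow (ord r) FinMap.targetFunctor :=
    StructuredArrow.mk (Y := o) (𝟙 (ord r))
  let e (i : Fin r) : ord (n i) ⟶ (FinMap.fiberFunctor r i).obj s :=
    FinSet.ofEquiv (X := ord (n i)) (Y := (FinMap.fiberFunctor r i).obj s)
    { toFun := fun x => ⟨⟨i, x⟩, rfl⟩
      invFun := fun y => cast (congrArg (fun k => Fin (n k)) y.2) y.1.2
      left_inv := fun x => rfl
      right_inv := by
        rintro ⟨⟨k, x⟩, hk⟩
        obtain rfl : k = i := hk
        rfl }
  refine ⟨s, fun i _ => e i, fun s' σ' => ?_⟩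
  let σ (i : Fin r) : Fin (n i) ≃ {x // s'.right.under.map x = FinMap.index s' i} :=
    FinSet.toEquiv (σ' i (List.mem_finRange i))
  -- The source is the disjoint union of its fibres, so the labellings of the fibres add up to a
  -- bijection of the sources.
  let θ : (Σ i : Fin r, Fin (n i)) ≃ s'.right.source.carrier :=
    (Equiv.sigmaCongr (FinMap.index s') σ).trans (Equiv.sigmaFiberEquiv s'.right.under.map)
  let t : o ⟶ s'.right := FinMap.Hom.mk (FinSet.ofEquiv (X := ⟨_⟩) (Y := s'.right.source) θ)
    (FinMap.index s') (fun x => (σ x.1 x.2).2)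
  refine ⟨StructuredArrow.homMk t rfl, fun i hi => Equiv.ext fun x => rfl, fun t' ht' => ?_⟩
  ext
  refine FinMap.Hom.ext (Equiv.ext fun ⟨i, x⟩ => ?_) (FinMap.index_comm t').symm
  exact congrArg (fun f : Fin (n i) ≃ {x // s'.right.under.map x = FinMap.index s' i} => (f x).1)
    (ht' i (List.mem_finRange i))

end SymSeq

/-! ### Maps out of a composition product as maps of diagrams -/

namespace SymSeq

/-- The functoriality of `twist` in the functor `Θ`. -/
def twistMap {C : Type u} [Category.{v} C] {O : Type u''} [Category.{v''} O] {D : Type u'}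
    [Category.{v'} D] (π : O ⥤ FinSet) {Θ Θ' : C ⥤ O ⥤ D} (α : Θ ⟶ Θ') (A : SymSeq C) :
    (twist π Θ).obj A ⟶ (twist π Θ').obj A where
  app o := (α.app (A.obj (π.obj o))).app o
  naturality o o' h := by
    change ((Θ.obj (A.obj (π.obj o))).map h ≫ (Θ.map (A.map (π.map h))).app o') ≫
      (α.app (A.obj (π.obj o'))).app o' = (α.app (A.obj (π.obj o))).app o ≫
        (Θ'.obj (A.obj (π.obj o))).map h ≫ (Θ'.map (A.map (π.map h))).app o'
    rw [Category.assoc, ← NatTrans.comp_app, α.naturality, NatTrans.comp_app,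
      NatTrans.naturality_assoc]

lemma twistMap_naturality {C : Type u} [Category.{v} C] {O : Type u''} [Category.{v''} O]
    {D : Type u'} [Category.{v'} D] (π : O ⥤ FinSet) {Θ Θ' : C ⥤ O ⥤ D} (α : Θ ⟶ Θ')
    {A A' : SymSeq C} (i : A ⟶ A') :
    twistMap π α A ≫ (twist π Θ').map i = (twist π Θ).map i ≫ twistMap π α A' := by
  ext o
  change (α.app _).app o ≫ (Θ'.map (i.app (π.obj o))).app o =
    (Θ.map (i.app (π.obj o))).app o ≫ (α.app _).app o
  rw [← NatTrans.comp_app, ← α.naturality, NatTrans.comp_app]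

variable {C : Type u} [Category.{v} C] [MonoidalCategory C] [SymmetricCategory C]

/-- The tensor products `⨂ i, N(f⁻¹(i))`, as a functor of `f`. -/
noncomputable def fiberTensor (N : SymSeq C) : FinMap ⥤ C where
  obj o := FamilyTensor.tensor fun i => N.obj (fiber o.under.map i)
  map h := FamilyTensor.tensorMap (FinMap.Hom.target h) fun i =>
    N.map (fiberMap (FinMap.Hom.source h) (FinMap.Hom.target h) (FinMap.Hom.comm h) i)
  map_id o := by
    refine Eq.trans ?_ (FamilyTensor.tensorMap_id _)
    exact congrArg (FamilyTensor.tensorMap (Equiv.refl _)) (funext fun i => N.map_id _)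
  map_comp h h' := by
    refine Eq.trans ?_ (FamilyTensor.tensorMap_comp _ _ _ _).symm
    exact congrArg (FamilyTensor.tensorMap _) (funext fun i => N.map_comp
      (fiberMap (FinMap.Hom.source h) (FinMap.Hom.target h) (FinMap.Hom.comm h) i)
      (fiberMap (FinMap.Hom.source h') (FinMap.Hom.target h') (FinMap.Hom.comm h') _))

/-- The functoriality of `fiberTensor`. -/
noncomputable def fiberTensorMap {N N' : SymSeq C} (n : N ⟶ N') :
    fiberTensor N ⟶ fiberTensor N' where
  app o := FamilyTensor.tensorMap (Equiv.refl _) fun i => n.app (fiber o.under.map i)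
  naturality o o' h := by
    refine (FamilyTensor.tensorMap_comp _ _ _ _).trans
      (Eq.trans ?_ (FamilyTensor.tensorMap_comp _ _ _ _).symm)
    exact congrArg (FamilyTensor.tensorMap (FinMap.Hom.target h)) (funext fun i =>
      n.naturality _)

/-- Tensoring with the tensor products of fibres. -/
noncomputable abbrev tensorFiber (N : SymSeq C) : C ⥤ FinMap ⥤ C :=
  curriedTensor C ⋙ (Functor.whiskeringLeft _ _ _).obj (fiberTensor N)

/-- The functoriality of `tensorFiber`. -/
noncomputable abbrev tensorFiberMap {N N' : SymSeq C} (n : N ⟶ N') :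
    tensorFiber N ⟶ tensorFiber N' :=
  Functor.whiskerLeft (curriedTensor C) ((Functor.whiskeringLeft _ _ _).map (fiberTensorMap n))

/-- The objects `(M, N)(f)`, as a functor of `M` and `f`. -/
noncomputable abbrev pairTwist (N : SymSeq C) : SymSeq C ⥤ FinMap ⥤ C :=
  twist FinMap.targetFunctor (tensorFiber N)

lemma pairTwist_map (M N : SymSeq C) {o o' : FinMap} (h : o ⟶ o') :
    ((pairTwist N).obj M).map h = pairMap (𝟙 M) (𝟙 N) (FinMap.Hom.source h)
      (FinMap.Hom.target h) (FinMap.Hom.comm h) := by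
  refine (tensorHom_def' _ _).symm.trans (congrArg₂ (· ⊗ₘ ·) (Category.id_comp _).symm ?_)
  exact congrArg (FamilyTensor.tensorMap _) (funext fun i => (Category.id_comp _).symm)

lemma pairTwist_map_app {M M' : SymSeq C} (m : M ⟶ M') (N : SymSeq C) (o : FinMap) :
    ((pairTwist N).map m).app o =
      pairMap (f := o.under) (f' := o.under) m (𝟙 N) (𝟙 _) (Equiv.refl _) (fun _ => rfl) := by
  refine (tensorHom_id _ _).symm.trans (congrArg₂ (· ⊗ₘ ·) ?_ ?_)
  · exact ((congrArg (m.app _ ≫ ·) (M'.map_id _)).trans (Category.comp_id _)).symm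
  · refine (FamilyTensor.tensorMap_id _).symm.trans
      (congrArg (FamilyTensor.tensorMap _) (funext fun i => ?_))
    exact ((Category.id_comp _).trans (N.map_id _)).symm

lemma twistMap_tensorFiberMap_app (M : SymSeq C) {N N' : SymSeq C} (n : N ⟶ N') (o : FinMap) :
    (twistMap FinMap.targetFunctor (tensorFiberMap n) M).app o =
      pairMap (f := o.under) (f' := o.under) (𝟙 M) n (𝟙 _) (Equiv.refl _) (fun _ => rfl) := by
  refine (id_tensorHom _ _).symm.trans (congrArg₂ (· ⊗ₘ ·) ?_ ?_)
  · exact ((Category.id_comp _).trans (M.map_id _)).symm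
  · refine congrArg (FamilyTensor.tensorMap (C := C) (Equiv.refl (Fin o.under.r)))
      (funext fun i => ?_)
    exact ((congrArg (n.app _ ≫ ·) (N'.map_id _)).trans (Category.comp_id _)).symm

variable [HasColimits C]

/-- The components of a morphism from a composition product. -/
noncomputable def circApp {M N X : SymSeq C} (u : (circ.obj M).obj N ⟶ X) (J : FinSet) :
    circObj M N J ⟶ X.obj J :=
  u.app J

lemma circApp_naturality {M N X : SymSeq C} (u : (circ.obj M).obj N ⟶ X) {J J' : FinSet}
    (θ : J ⟶ J') : circMap (𝟙 M) (𝟙 N) θ ≫ circApp u J' = circApp u J ≫ X.map θ :=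
  u.naturality θ

/-- The morphism of diagrams corresponding to a morphism from a composition product. -/
noncomputable def circRestrict {M N X : SymSeq C} (u : (circ.obj M).obj N ⟶ X) :
    (pairTwist N).obj M ⟶ FinMap.sourceFunctor ⋙ X where
  app o := circι M N o.under ≫ circApp u o.source
  naturality o o' h := by
    refine (congrArg (· ≫ circι M N o'.under ≫ circApp u o'.source)
      (pairTwist_map M N h)).trans ?_
    change pairMap (𝟙 M) (𝟙 N) _ _ _ ≫ circι M N o'.under ≫ circApp u o'.source =
      (circι M N o.under ≫ circApp u o.source) ≫ X.map (FinMap.Hom.source h)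
    rw [Category.assoc, ← circApp_naturality, ← Category.assoc, ← Category.assoc,
      circι_circMap (𝟙 M) (𝟙 N) (FinMap.Hom.source h) o.under o'.under
        (FinMap.Hom.target h) (FinMap.Hom.comm h)]

lemma circ_hom_ext {M N X : SymSeq C} {u u' : (circ.obj M).obj N ⟶ X}
    (h : circRestrict u = circRestrict u') : u = u' := by
  ext J
  exact circObj_hom_ext fun f => NatTrans.congr_app h ⟨J, f⟩

/-- Together with `circ_hom_ext` this says that `M ∘ N` is the left Kan extension of the diagram of
the `(M, N)(f)` along `FinMap.sourceFunctor`. The colimit over `UnderFin J` gives the components,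
and naturality in `θ` comes from the morphism `f ⟶ f ∘ θ⁻¹` of `FinMap` lying over `θ`. -/
lemma exists_circRestrict_eq {M N X : SymSeq C}
    (d : (pairTwist N).obj M ⟶ FinMap.sourceFunctor ⋙ X) :
    ∃ u : (circ.obj M).obj N ⟶ X, circRestrict u = d := by
  have hd : ∀ {o o' : FinMap} (h : o ⟶ o'), pairMap (𝟙 M) (𝟙 N) (FinMap.Hom.source h)
      (FinMap.Hom.target h) (FinMap.Hom.comm h) ≫ d.app o' =
        d.app o ≫ X.map (FinMap.Hom.source h) := fun h => by
    rw [← pairTwist_map]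
    exact d.naturality h
  let ε (J : FinSet) : circObj M N J ⟶ X.obj J :=
    colimit.desc (pairFunctor M N J)
      { pt := X.obj J
        ι :=
          { app := fun f => d.app ⟨J, f⟩
            naturality := fun f f' p =>
              (hd (o := ⟨J, f⟩) (o' := ⟨J, f'⟩)
                (FinMap.Hom.mk (𝟙 J) (UnderFin.Hom.equiv p) (UnderFin.Hom.comm_id p))).trans
                (congrArg (d.app _ ≫ ·) (X.map_id J)) } }
  have fac : ∀ (J : FinSet) (f : UnderFin J), circι M N f ≫ ε J = d.app ⟨J, f⟩ :=
    fun J f => colimit.ι_desc _ _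
  refine ⟨⟨ε, fun J J' θ => circObj_hom_ext fun f => ?_⟩, ?_⟩
  · change circι M N f ≫ circMap (𝟙 M) (𝟙 N) θ ≫ ε J' = circι M N f ≫ ε J ≫ X.map θ
    rw [← Category.assoc, circι_circMap (𝟙 M) (𝟙 N) θ f (f.push θ) (f.pushEquiv θ)
      (f.push_apply θ), Category.assoc, fac, ← Category.assoc, fac]
    exact hd (o := ⟨J, f⟩) (o' := ⟨J', f.push θ⟩)
      (FinMap.Hom.mk θ (f.pushEquiv θ) (f.push_apply θ))
  · ext o
    exact fac o.source o.under

lemma circRestrict_map {M M' N X : SymSeq C} (m : M ⟶ M') (u : (circ.obj M').obj N ⟶ X) :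
    circRestrict ((circ.map m).app N ≫ u) = (pairTwist N).map m ≫ circRestrict u := by
  ext o
  refine Eq.trans ?_ (congrArg (· ≫ circι M' N o.under ≫ circApp u o.source)
    (pairTwist_map_app m N o)).symm
  change circι M N o.under ≫ circMap m (𝟙 N) (𝟙 _) ≫ circApp u o.source =
    pairMap m (𝟙 N) _ _ _ ≫ circι M' N o.under ≫ circApp u o.source
  rw [← Category.assoc, circι_circMap _ _ _ o.under o.under (Equiv.refl _) (fun _ => rfl),
    Category.assoc]

lemma circRestrict_obj_map {M N N' X : SymSeq C} (n : N ⟶ N') (u : (circ.obj M).obj N' ⟶ X) :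
    circRestrict ((circ.obj M).map n ≫ u) =
      twistMap FinMap.targetFunctor (tensorFiberMap n) M ≫ circRestrict u := by
  ext o
  refine Eq.trans ?_ (congrArg (· ≫ circι M N' o.under ≫ circApp u o.source)
    (twistMap_tensorFiberMap_app M n o)).symm
  change circι M N o.under ≫ circMap (𝟙 M) n (𝟙 _) ≫ circApp u o.source =
    pairMap (𝟙 M) n _ _ _ ≫ circι M N' o.under ≫ circApp u o.source
  rw [← Category.assoc, circι_circMap _ _ _ o.under o.under (Equiv.refl _) (fun _ => rfl),
    Category.assoc]

lemma circRestrict_comp {M N X Y : SymSeq C} (u : (circ.obj M).obj N ⟶ X) (x : X ⟶ Y) :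
    circRestrict (u ≫ x) = circRestrict u ≫ Functor.whiskerLeft FinMap.sourceFunctor x := by
  ext o
  exact (Category.assoc _ _ _).symm

/-- The lifting property of the corner map of a composition product follows from a corner lifting
property of diagrams indexed by maps of finite sets. -/
lemma hasLiftingProperty_circCorner {A A' B B' X Y : SymSeq C} (i : A ⟶ A') (j : B ⟶ B')
    (x : X ⟶ Y)
    (h : CornerLift (twistMap FinMap.targetFunctor (tensorFiberMap j) A) ((pairTwist B).map i)
      ((pairTwist B').map i) (twistMap FinMap.targetFunctor (tensorFiberMap j) A')
      (Functor.whiskerLeft FinMap.sourceFunctor x)) :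
    HasLiftingProperty (circCorner i j) x := by
  refine CornerLift.hasLiftingProperty_of_pushout
    (IsPushout.of_hasPushout ((circ.map i).app B) ((circ.obj A).map j))
    (pushout.inl_desc _ _ _) (pushout.inr_desc _ _ _) (CornerLift.symm ?_)
  intro u v t e1 e2 e3
  obtain ⟨d, h1, h2, h3⟩ := h (circRestrict u) (circRestrict v) (circRestrict t)
    (by rw [← circRestrict_obj_map, ← circRestrict_map, e1])
    (by rw [← circRestrict_comp, ← circRestrict_map, e2])
    (by rw [← circRestrict_comp, ← circRestrict_obj_map, e3])
  obtain ⟨d, rfl⟩ := exists_circRestrict_eq d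
  exact ⟨d, circ_hom_ext (by rw [circRestrict_map, h1]),
    circ_hom_ext (by rw [circRestrict_obj_map, h2]), circ_hom_ext (by rw [circRestrict_comp, h3])⟩

end SymSeq

/-! ### Comparison of the bracketings of iterated tensor products -/

namespace FamilyTensor

variable {C : Type u} [Category.{v} C] [MonoidalCategory C]

/-- The morphism between iterated tensor products given by morphisms on the factors. -/
def listTensorMap {I : Type} {X X' : I → C} (φ : ∀ i, X i ⟶ X' i) :
    ∀ l : List I, listTensor X l ⟶ listTensor X' l
  | [] => 𝟙 _
  | a :: l => φ a ⊗ₘ listTensorMap φ l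

variable [SymmetricCategory C]

instance (X Y Z : C) : IsIso (swapFront X Y Z) :=
  ⟨swapFront Y X Z, swapFront_swapFront X Y Z, swapFront_swapFront Y X Z⟩

lemma Ins.isIso_hom {I : Type} (X : I → C) {a : I} {t l : List I} (p : Ins a t l) :
    IsIso (p.hom X) := by
  induction p with
  | here t => exact inferInstanceAs (IsIso (𝟙 _))
  | there b p ih => exact inferInstanceAs (IsIso (swapFront _ _ _ ≫ X b ◁ p.hom X))

lemma Match.isIso_hom {I I' : Type} {s : I → I'} {X : I → C} {X' : I' → C}
    (φ : ∀ a, X a ⟶ X' (s a)) (hφ : ∀ a, IsIso (φ a)) {l : List I} {l' : List I'}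
    (p : Match s l l') : IsIso (p.hom φ) := by
  induction p with
  | nil => exact inferInstanceAs (IsIso (𝟙 _))
  | @cons a t t' l' p q ih =>
    have := q.isIso_hom X'
    exact inferInstanceAs (IsIso ((φ a ⊗ₘ p.hom φ) ≫ q.hom X'))

lemma isIso_tensorMap {r r' : ℕ} {X : Fin r → C} {X' : Fin r' → C} (σ : Fin r ≃ Fin r')
    (φ : ∀ i, X i ⟶ X' (σ i)) (hφ : ∀ i, IsIso (φ i)) : IsIso (tensorMap σ φ) :=
  Match.isIso_hom φ hφ _

lemma Match.exists_hom_eq_listTensorMap {I : Type} {X X' : I → C} (φ : ∀ i, X i ⟶ X' i)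
    (l : List I) : ∃ p : Match id l l, p.hom φ = listTensorMap φ l := by
  induction l with
  | nil => exact ⟨.nil, rfl⟩
  | cons a l ih =>
    obtain ⟨p, hp⟩ := ih
    refine ⟨.cons p (.here l), ?_⟩
    refine (Category.comp_id _).trans ?_
    rw [hp]
    rfl

/-- The chosen reordering for the identity bijection is the trivial one, since a list without
repetition has only one `Match`. -/
lemma tensorMap_refl {r : ℕ} {X X' : Fin r → C} (φ : ∀ i, X i ⟶ X' i) :
    tensorMap (Equiv.refl (Fin r)) φ = listTensorMap φ (List.finRange r) := by
  obtain ⟨q, hq⟩ := Match.exists_hom_eq_listTensorMap φ (List.finRange r)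
  have e : q = Match.ofEquiv (Equiv.refl _) := Match.unique (List.nodup_finRange _) _ _
  exact (by rw [e]; rfl : _ = q.hom _).trans hq

end FamilyTensor

namespace SymSeq

section

variable {C : Type u} [Category.{v} C]
variable {O : Type u''} [Category.{v''} O] {D : Type u'} [Category.{v'} D]

/-- The joint functoriality of a functor of three variables. -/
def mapThree (Γ : SymSeq C ⥤ C ⥤ O ⥤ D) {N N' : SymSeq C} (n : N ⟶ N') {K K' : C} (k : K ⟶ K')
    {o o' : O} (h : o ⟶ o') : ((Γ.obj N).obj K).obj o ⟶ ((Γ.obj N').obj K').obj o' :=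
  ((Γ.map n).app K).app o ≫ ((Γ.obj N').map k).app o ≫ ((Γ.obj N').obj K').map h

lemma mapThree_id_id (Γ : SymSeq C ⥤ C ⥤ O ⥤ D) (N : SymSeq C) (K : C) {o o' : O} (h : o ⟶ o') :
    mapThree Γ (𝟙 N) (𝟙 K) h = ((Γ.obj N).obj K).map h := by
  simp [mapThree]

lemma mapThree_id_left_right (Γ : SymSeq C ⥤ C ⥤ O ⥤ D) (N : SymSeq C) {K K' : C} (k : K ⟶ K')
    (o : O) : mapThree Γ (𝟙 N) k (𝟙 o) = ((Γ.obj N).map k).app o := by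
  simp [mapThree]

lemma mapThree_id_right (Γ : SymSeq C ⥤ C ⥤ O ⥤ D) {N N' : SymSeq C} (n : N ⟶ N') (K : C)
    (o : O) : mapThree Γ n (𝟙 K) (𝟙 o) = ((Γ.map n).app K).app o := by
  simp [mapThree]

variable [MonoidalCategory C]

/-- Carrying all three variables at once lets the induction in `listTwistIso_naturality` absorb a
factor into `k`; naturality in each single variable follows by taking the others to be identities.
-/
lemma mapThree_consTwist (π : O ⥤ FinSet) (Γ : SymSeq C ⥤ C ⥤ O ⥤ D) {N N' : SymSeq C}
    (n : N ⟶ N') {K K' : C} (k : K ⟶ K') {o o' : O} (h : o ⟶ o') :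
    mapThree (consTwist π Γ) n k h =
      mapThree Γ n (k ⊗ₘ (n.app (π.obj o) ≫ N'.map (π.map h))) h := by
  change (((Γ.map n).app (K ⊗ N.obj (π.obj o))).app o ≫
    ((Γ.obj N').map (K ◁ n.app (π.obj o))).app o) ≫
      ((Γ.obj N').map (k ▷ N'.obj (π.obj o))).app o ≫
        ((Γ.obj N').obj (K' ⊗ N'.obj (π.obj o))).map h ≫
          ((Γ.obj N').map (K' ◁ N'.map (π.map h))).app o' =
    ((Γ.map n).app (K ⊗ N.obj (π.obj o))).app o ≫
      ((Γ.obj N').map (k ⊗ₘ (n.app (π.obj o) ≫ N'.map (π.map h)))).app o ≫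
        ((Γ.obj N').obj (K' ⊗ N'.obj (π.obj o'))).map h
  have e : k ⊗ₘ (n.app (π.obj o) ≫ N'.map (π.map h)) = K ◁ n.app (π.obj o) ≫
      k ▷ N'.obj (π.obj o) ≫ K' ◁ N'.map (π.map h) := by
    rw [MonoidalCategory.tensorHom_def, whisker_exchange_assoc]
    simp
  rw [e, Functor.map_comp, Functor.map_comp, NatTrans.comp_app, NatTrans.comp_app]
  simp only [Category.assoc, NatTrans.naturality]

variable {I : Type} (π : I → O ⥤ FinSet)

/-- The comparison of the two bracketings of an iterated tensor product. -/
def listTwistIso : ∀ (l : List I) (N : SymSeq C) (K : C) (o : O),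
    K ⊗ FamilyTensor.listTensor (fun i => N.obj ((π i).obj o)) l ≅
      (((listTwist π l).obj N).obj K).obj o
  | [], _, K, _ => ρ_ K
  | a :: l, N, K, o => (α_ K (N.obj ((π a).obj o)) _).symm ≪≫
      listTwistIso l N (K ⊗ N.obj ((π a).obj o)) o

lemma listTwistIso_naturality (l : List I) {N N' : SymSeq C} (n : N ⟶ N') {K K' : C} (k : K ⟶ K')
    {o o' : O} (h : o ⟶ o') :
    (k ⊗ₘ FamilyTensor.listTensorMap
      (fun i => n.app ((π i).obj o) ≫ N'.map ((π i).map h)) l) ≫ (listTwistIso π l N' K' o').hom =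
        (listTwistIso π l N K o).hom ≫ mapThree (listTwist π l) n k h := by
  induction l generalizing K K' with
  | nil =>
    change (k ⊗ₘ 𝟙 (𝟙_ C)) ≫ (ρ_ K').hom = (ρ_ K).hom ≫ 𝟙 K ≫ k ≫ 𝟙 K'
    simp
  | cons a l ih =>
    change (k ⊗ₘ (n.app ((π a).obj o) ≫ N'.map ((π a).map h)) ⊗ₘ FamilyTensor.listTensorMap _ l) ≫
      (α_ _ _ _).inv ≫ (listTwistIso π l N' _ o').hom =
        ((α_ _ _ _).inv ≫ (listTwistIso π l N _ o).hom) ≫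
          mapThree (consTwist (π a) (listTwist π l)) n k h
    rw [mapThree_consTwist]
    refine Eq.trans ?_ ((congrArg ((α_ _ _ _).inv ≫ ·) (ih _)).trans (Category.assoc _ _ _).symm)
    exact associator_inv_naturality_assoc _ _ _ _

end

end SymSeq

/-! ### Tensor products of fibres on structured arrows, and the corner map -/

namespace SymSeq

section

variable {C : Type u} [Category.{v} C] [MonoidalCategory C] [SymmetricCategory C]

/-- The relation between the labellings of two structured arrows is only a propositional equality,
and the labellings occur in the types of the fibres. With `τ'` a variable it can be substituted,
after which both sides agree by definition. -/
lemma tensorMap_fiberEquiv {N N' : SymSeq C} (n : N ⟶ N') {J J' : FinSet} {r r' s : ℕ}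
    {f : J.carrier → Fin r} {f' : J'.carrier → Fin r'} (θ : J ⟶ J') (σ : Fin r ≃ Fin r')
    (h : ∀ x, f' (FinSet.toEquiv θ x) = σ (f x)) (τ : Fin s ≃ Fin r) (τ' : Fin s ≃ Fin r')
    (hτ : τ' = τ.trans σ) (h' : ∀ i x, f x = τ i ↔ f' (FinSet.toEquiv θ x) = τ' i) :
    FamilyTensor.tensorMap (X' := fun i => N'.obj (fiber f' i)) τ'
      (fun i => n.app (fiber f (τ i)) ≫ N'.map (fiberEquiv θ (h' i))) =
    FamilyTensor.tensorMap (τ.trans σ)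
      (fun i => n.app (fiber f (τ i)) ≫ N'.map (fiberMap θ σ h (τ i))) := by
  subst hτ
  rfl

variable {r : ℕ}

/-- The reordering of a tensor product of fibres along an identification of the target. -/
noncomputable def fiberTensorReindex (N : SymSeq C)
    (s : StructuredArrow (ord r) FinMap.targetFunctor) :
    FamilyTensor.listTensor (fun i => N.obj ((FinMap.fiberFunctor r i).obj s)) (List.finRange r) ⟶
      (fiberTensor N).obj s.right :=
  FamilyTensor.tensorMap (X := fun i => N.obj ((FinMap.fiberFunctor r i).obj s))
    (X' := fun i => N.obj (fiber s.right.under.map i)) (FinMap.index s) fun _ => 𝟙 _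

instance (N : SymSeq C) (s : StructuredArrow (ord r) FinMap.targetFunctor) :
    IsIso (fiberTensorReindex N s) :=
  FamilyTensor.isIso_tensorMap _ _ fun _ => inferInstanceAs (IsIso (𝟙 _))

lemma fiberTensorMap_comp_map {N N' : SymSeq C} (n : N ⟶ N') {o o' : FinMap} (h : o ⟶ o') :
    (fiberTensorMap n).app o ≫ (fiberTensor N').map h =
      FamilyTensor.tensorMap (FinMap.Hom.target h) fun i => n.app (fiber o.under.map i) ≫
        N'.map (fiberMap (FinMap.Hom.source h) (FinMap.Hom.target h) (FinMap.Hom.comm h) i) :=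
  FamilyTensor.tensorMap_comp (X := fun i => N.obj (fiber o.under.map i))
    (X' := fun i => N'.obj (fiber o.under.map i)) (X'' := fun i => N'.obj (fiber o'.under.map i))
    (Equiv.refl (Fin o.under.r)) (FinMap.Hom.target h)
    (fun i => n.app (fiber o.under.map i)) fun i => N'.map (fiberMap (FinMap.Hom.source h)
      (FinMap.Hom.target h) (FinMap.Hom.comm h) i)

lemma fiberTensorMap_id_app (N : SymSeq C) (o : FinMap) :
    (fiberTensorMap (𝟙 N)).app o = 𝟙 ((fiberTensor N).obj o) :=
  FamilyTensor.tensorMap_id _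

lemma fiberTensorReindex_naturality {N N' : SymSeq C} (n : N ⟶ N')
    {s s' : StructuredArrow (ord r) FinMap.targetFunctor} (h : s ⟶ s') :
    FamilyTensor.listTensorMap (fun i => n.app ((FinMap.fiberFunctor r i).obj s) ≫
      N'.map ((FinMap.fiberFunctor r i).map h)) (List.finRange r) ≫ fiberTensorReindex N' s' =
    fiberTensorReindex N s ≫ (fiberTensorMap n).app s.right ≫ (fiberTensor N').map h.right := by
  rw [← FamilyTensor.tensorMap_refl, fiberTensorMap_comp_map]
  refine (FamilyTensor.tensorMap_comp _ _ _ _).trans (Eq.trans ?_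
    (FamilyTensor.tensorMap_comp _ _ _ _).symm)
  refine Eq.trans ?_ ((tensorMap_fiberEquiv n (FinMap.Hom.source h.right)
    (FinMap.Hom.target h.right) (FinMap.Hom.comm h.right) (FinMap.index s) (FinMap.index s')
    (FinMap.index_comm h) (FinMap.fiber_iff h)).trans ?_)
  · exact congrArg (FamilyTensor.tensorMap _) (funext fun i => Category.comp_id _)
  · exact congrArg (FamilyTensor.tensorMap _) (funext fun i => (Category.id_comp _).symm)

/-- On structured arrows, tensoring with the tensor product of fibres is an instance of
`listTwist`. -/
noncomputable def tensorFiberIsoApp (N : SymSeq C) (K : C)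
    (s : StructuredArrow (ord r) FinMap.targetFunctor) :
    K ⊗ (fiberTensor N).obj s.right ≅
      (((listTwist (FinMap.fiberFunctor r) (List.finRange r)).obj N).obj K).obj s :=
  (whiskerLeftIso K (asIso (fiberTensorReindex N s))).symm ≪≫ listTwistIso _ _ N K s

/-- This combines the reordering of the factors with the rebracketing; `tensorFiberIso` and its
compatibility with `k` and with `n` are its specializations. -/
lemma tensorFiberIsoApp_naturality {N N' : SymSeq C} (n : N ⟶ N') {K K' : C} (k : K ⟶ K')
    {s s' : StructuredArrow (ord r) FinMap.targetFunctor} (h : s ⟶ s') :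
    (k ⊗ₘ ((fiberTensorMap n).app s.right ≫ (fiberTensor N').map h.right)) ≫
      (tensorFiberIsoApp N' K' s').hom = (tensorFiberIsoApp N K s).hom ≫
        mapThree (listTwist (FinMap.fiberFunctor r) (List.finRange r)) n k h := by
  have e := listTwistIso_naturality (FinMap.fiberFunctor r) (List.finRange r) n k h
  have e' := fiberTensorReindex_naturality n h
  change _ ≫ (whiskerLeftIso K' (asIso (fiberTensorReindex N' s'))).inv ≫ _ =
    ((whiskerLeftIso K (asIso (fiberTensorReindex N s))).inv ≫ _) ≫ _
  rw [Category.assoc, Iso.eq_inv_comp, ← e]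
  rw [← Category.assoc, ← Category.assoc]
  congr 1
  rw [Iso.comp_inv_eq]
  change K ◁ fiberTensorReindex N s ≫ _ = _ ≫ K' ◁ fiberTensorReindex N' s'
  rw [whiskerLeft_comp_tensorHom, tensorHom_comp_whiskerLeft, ← e']

/-- `tensorFiberIsoApp`, as an isomorphism of functors. -/
noncomputable def tensorFiberIso (r : ℕ) (N : SymSeq C) (K : C) :
    StructuredArrow.proj (ord r) FinMap.targetFunctor ⋙ (tensorFiber N).obj K ≅
      ((listTwist (FinMap.fiberFunctor r) (List.finRange r)).obj N).obj K :=
  NatIso.ofComponents (fun s => tensorFiberIsoApp N K s) fun {s s'} h => by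
    have e := tensorFiberIsoApp_naturality (𝟙 N) (𝟙 K) h
    rw [fiberTensorMap_id_app, Category.id_comp, id_tensorHom, mapThree_id_id] at e
    exact e

lemma tensorFiberIso_map (N : SymSeq C) {K K' : C} (k : K ⟶ K') :
    Functor.whiskerLeft (StructuredArrow.proj (ord r) FinMap.targetFunctor)
      ((tensorFiber N).map k) ≫ (tensorFiberIso r N K').hom = (tensorFiberIso r N K).hom ≫
        ((listTwist (FinMap.fiberFunctor r) (List.finRange r)).obj N).map k := by
  ext s
  have e := tensorFiberIsoApp_naturality (𝟙 N) k (𝟙 s)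
  rw [fiberTensorMap_id_app, Category.id_comp, StructuredArrow.id_right, CategoryTheory.Functor.map_id,
    tensorHom_id, mapThree_id_left_right] at e
  exact e

lemma tensorFiberIso_tensorFiberMap {N N' : SymSeq C} (n : N ⟶ N') (K : C) :
    Functor.whiskerLeft (StructuredArrow.proj (ord r) FinMap.targetFunctor)
      ((tensorFiberMap n).app K) ≫ (tensorFiberIso r N' K).hom = (tensorFiberIso r N K).hom ≫
        ((listTwist (FinMap.fiberFunctor r) (List.finRange r)).map n).app K := by
  ext s
  have e := tensorFiberIsoApp_naturality n (𝟙 K) (𝟙 s)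
  rw [StructuredArrow.id_right, CategoryTheory.Functor.map_id, Category.comp_id, id_tensorHom,
    mapThree_id_right] at e
  exact e

end

variable {C : Type u} [Category.{v} C] [MonoidalCategory C] [SymmetricCategory C]
  [ModelCategory C] [SymmetricMonoidalModel C]

lemma preservesColimitsOfSize_tensorFiber (N : SymSeq C) (o : FinMap) :
    PreservesColimitsOfSize.{v, v} (tensorFiber N ⋙ (evaluation FinMap C).obj o) :=
  inferInstanceAs (PreservesColimitsOfSize.{v, v} (tensorRight ((fiberTensor N).obj o)))

variable [HasColimits C] [CofibrantlyGenerated C]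

/-- The pushout-corner map of a composition product is a projective cofibration, which is trivial
if one of the two morphisms is. -/
lemma projCof_circCorner {a b : Bool} {A A' B B' : SymSeq C} (i : A ⟶ A') (j : B ⟶ B')
    (hi : projCof C a i) (hj : projCof C b j) [IsCofibrant B] [IsCofibrant B'] :
    projCof C (a || b) (circCorner i j) := by
  intro X Y p hp
  refine hasLiftingProperty_circCorner i j p ?_
  refine (hasLiftingProperty_natArrowHat_iff _ _
    (twistMap_naturality FinMap.targetFunctor (tensorFiberMap j) i) _).1 ?_
  -- With the change from `B` to `B'` encoded in an arrow-valued functor, only `i` varies, and it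
  -- may be replaced by a free morphism on `k`.
  refine hasLiftingProperty_twist FinMap.targetFunctor (natArrow₂ (tensorFiberMap j))
    (fun o => preservesColimitsOfSize_natArrow₂ _ o (preservesColimitsOfSize_tensorFiber B o)
      (preservesColimitsOfSize_tensorFiber B' o)) a _ (fun r K K' k hk => ?_) i hi
  refine (hasLiftingProperty_natArrowHat_iff
    (α := Functor.whiskerLeft (StructuredArrow.proj (ord r) FinMap.targetFunctor)
      ((tensorFiberMap j).app K))
    (α' := Functor.whiskerLeft (StructuredArrow.proj (ord r) FinMap.targetFunctor)
      ((tensorFiberMap j).app K'))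
    (Functor.whiskerLeft (StructuredArrow.proj (ord r) FinMap.targetFunctor)
      ((tensorFiber B).map k))
    (Functor.whiskerLeft (StructuredArrow.proj (ord r) FinMap.targetFunctor)
      ((tensorFiber B').map k))
    (congrArg (Functor.whiskerLeft (StructuredArrow.proj (ord r) FinMap.targetFunctor))
      ((tensorFiberMap j).naturality k).symm)
    (Functor.whiskerLeft (StructuredArrow.proj (ord r) FinMap.targetFunctor)
      (Functor.whiskerLeft FinMap.sourceFunctor p))).2 ?_
  -- Once the target is labelled, the tensor product over the fibres is an ordered one, and the
  -- corner lifting property for lists of factors applies.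
  exact CornerLift.of_iso (tensorFiberIso r B K) (tensorFiberIso r B' K) (tensorFiberIso r B K')
    (tensorFiberIso r B' K') (tensorFiberIso_tensorFiberMap j K) (tensorFiberIso_map B k)
    (tensorFiberIso_map B' k) (tensorFiberIso_tensorFiberMap j K')
    (cornerLift_listTwist _ _ (rigid_fiberFunctor r) j hj k hk _ fun s => hp _)

end SymSeq

theorem mainTheorem10 {C : Type u} [Category.{v} C] [MonoidalCategory C] [SymmetricCategory C]
    [ModelCategory C] [HasColimits C] [CofibrantlyGenerated C] [SymmetricMonoidalModel C]
    {A A' B B' : SymSeq C} (i : A ⟶ A') (j : B ⟶ B') (hi : Cofibration i) (hj : Cofibration j)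
    (hB : IsCofibrant B) (hB' : IsCofibrant B') :
    Cofibration (SymSeq.circCorner i j) ∧
      (WeakEquivalence i ∨ WeakEquivalence j → WeakEquivalence (SymSeq.circCorner i j)) := by
  have hi' := (SymSeq.cofibration_iff_projCof i).1 hi
  have hj' := (SymSeq.cofibration_iff_projCof j).1 hj
  refine ⟨(SymSeq.cofibration_iff_projCof _).2 (SymSeq.projCof_circCorner i j hi' hj'), ?_⟩
  rintro (h | h)
  · exact SymSeq.weakEquivalence_of_projCof_true _ (SymSeq.projCof_circCorner i j
      (SymSeq.projCof_true_of_weakEquivalence i hi h) hj')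
  · exact SymSeq.weakEquivalence_of_projCof_true _ (SymSeq.projCof_circCorner i j hi'
      (SymSeq.projCof_true_of_weakEquivalence j hj h))
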